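/- **Setting.** Let $\mathcal P=\{P_1,\dots,P_n\}$, let $\mathcal Z\subseteq 2^{\mathcal P}$ describe the adversary structure, and let $P_S\in\mathcal P$ be the sender. A set $C\subseteq\mathcal P$ is *corruptible* if $C\subseteq Z$ for some $Z\in\mathcal Z$ (if $\mathcal Z$ is closed under subsets, this is $C\in\mathcal Z$). $\mathcal Z$ satisfies $\mathbb Q^{(3)}(\mathcal P,\mathcal Z)$ if $\mathcal P\not\subseteq Z_1\cup Z_2\cup Z_3$ for all $Z_1,Z_2,Z_3\in\mathcal Z$ (repetitions allowed). All machines below are probabilistic and computationally unbounded. **Protocol $\Pi_{\mathsf{Acast}}$ for $\ell$-bit messages.** The sender, on its (first) input $m\in\{0,1\}^\ell$, sends $(\mathsf{inp},m)$ to all parties. Each party $P_i$ (including $P_S$): (1) on receiving the first $(\mathsf{inp},m)$ from $P_S$, sends $(\mathsf{echo},m)$ to all parties; (2) if $(\mathsf{echo},m')$ has been received from all parties of $\mathcal P\setminus Z$ for some $Z\in\mathcal Z$, sends $(\mathsf{ready},m')$ to all parties; (3) if $(\mathsf{ready},m')$ has been received from a set of parties that is not corruptible, sends $(\mathsf{ready},m')$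 to all parties; (4) if $(\mathsf{ready},m')$ has been received from all parties of $\mathcal P\setminus Z$ for some $Z\in\mathcal Z$, outputs $m'$. A party sends at most one $\mathsf{echo}$ and at most one $\mathsf{ready}$ message to each party and outputs at most once. A message is a bit string consisting of a 2-bit tag and $\ell$ bits of content; ill-formed strings are ignored. **Real world.** A static malicious adversary $\mathsf{Adv}$ controls a corruptible set $Z^\star$ and has an auxiliary input $z$. The environment $\mathsf{Env}$ repeatedly either activates a party, possibly with an input, or sends a message to $\mathsf{Adv}$ and gets an answer, until it stops with an output bit. The parties are connected by pairwise secure (private and authenticated) asynchronous channels: $\mathsf{Adv}$ sees messages to corrupt parties and the lengths and delivery status of all others, may send messages on behalf of corrupt parties, and may at any of its activations delay any message by finitely many further activations of its recipient. When $\mathsf{Env}$ activates an honest party, $\mathsf{Adv}$ is told (and may act and send $\mathsf{Env}$ a message), then the party receives the messages that are due, computes, sends messages, and possibly hands an output to $\mathsf{Env}$, to which control returns. An activation of a corrupt party is passed to $\mathsf{Adv}$. **Ideal world with $\mathcal F_{\mathsf{Acast}}$.** Honest dummy parties forward inputs to $\mathcal F_{\mathsf{Acast}}$, and each activation of an honest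 dummy party is also a request for its output. On the first message $m\in\{0,1\}^\ell$ from $P_S$ (from the simulator $\mathcal S$ if $P_S\in Z^\star$), $\mathcal F_{\mathsf{Acast}}$ records $m$, sends $m$ to $\mathcal S$ if $P_S$ is honest, and prepares a request-based delayed output $m$ for every honest party: $\mathcal S$ is told about each activation of an honest party and may instruct $\mathcal F_{\mathsf{Acast}}$ to ignore a finite number of further requests of a party; a request that is not ignored is answered with $m$, once per party. **Perfect UC security.** $\Pi$ *UC-securely realizes* $\mathcal F$ *with perfect security* if for every $\mathsf{Adv}$ there is a simulator $\mathcal S$ such that * $\mathcal S$ consists of one copy of the real-world execution with $\mathsf{Adv}$ and virtual honest parties, advanced by exactly one event per activation of $\mathcal S$, together with a finite-state control (so that its running time is linear in that of the virtual execution, in particular polynomial in that of $\mathsf{Adv}$); * if $\mathsf{Adv}$ respects eventual delivery (in every infinite execution in which all honest parties are activated infinitely often, every message between honest parties is delivered), then so does $\mathcal S$ (in every infinite ideal execution in which all honest parties are activated infinitely often, every honest party for which an output is prepared obtains it); * for every corruptible $Z^\star$, every $z\in\{0,1\}^\star$, every environment $\mathsf{Env}$ and every $k$, the output of $\mathsf{Env}$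 within its first $k$ activations has the same distribution in the real world with $\Pi,\mathsf{Adv}$ and in the ideal world with $\mathcal F,\mathcal S$. **Theorem.** There is an absolute constant $c$ such that for all $n$, all $\mathcal Z$ satisfying $\mathbb Q^{(3)}(\mathcal P,\mathcal Z)$, every sender $P_S$ and every $\ell\ge 0$: the protocol $\Pi_{\mathsf{Acast}}$ UC-securely realizes $\mathcal F_{\mathsf{Acast}}$ with perfect security; and if $\ell\ge 1$, then in every execution, whatever the environment and the adversary (corrupting any corruptible set) do, the honest parties send at most $c\,n^2\ell$ bits in total, i.e. the protocol incurs a communication of $O(n^2\ell)$ bits. -/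

import Mathlib

namespace AsyncUC

/-! ### Adversary structures -/

/-- `Q k P 𝒵`: no `k` (not necessarily distinct) members of `𝒵` cover `P`. -/
def Q {n : ℕ} (k : ℕ) (P : Finset (Fin n)) (𝒵 : Finset (Finset (Fin n))) : Prop :=
  ∀ Z : Fin k → Finset (Fin n), (∀ j, Z j ∈ 𝒵) → ¬ P ⊆ Finset.univ.biUnion Z

/-- `C` may be corrupted: `C` lies in the adversary structure given by `𝒵`. If `𝒵` lists all the
corruptible sets (so that it is closed under subsets) this is `C ∈ 𝒵`; if `𝒵` lists only the maximal
ones, it is membership in the structure they generate. -/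
abbrev Corruptible {n : ℕ} (𝒵 : Finset (Finset (Fin n))) (C : Finset (Fin n)) : Prop :=
  ∃ Z ∈ 𝒵, C ⊆ Z

/-- `C` contains `P \ Z` for some `Z ∈ 𝒵`. -/
abbrev IsQuorum {n : ℕ} (𝒵 : Finset (Finset (Fin n))) (C : Finset (Fin n)) : Prop :=
  ∃ Z ∈ 𝒵, Finset.univ \ Z ⊆ C

/-! ### Protocols, environments, adversaries

Every entity is a probabilistic reactive machine without any bound on its computing power.
Channels carry bit strings. The definitions concern one session. -/

/-- An `n`-party protocol. When party `i` is activated by the environment, possibly with an input, it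
also receives the messages that its incoming channels release at that moment (with the identity of
their senders); it then sends messages and possibly hands an output to the environment. -/
structure Protocol (n : ℕ) (In Out : Type) where
  State : Type
  init : Fin n → State
  step : Fin n → State → Option In → List (Fin n × List Bool) →
    PMF (State × List (Fin n × List Bool) × Option Out)

/-- What the environment can do: activate a party, possibly with an input (an activation is also the
party's request for messages, or for output from the functionality), or send the adversary a message. -/
inductive EnvAction (n : ℕ) (In : Type) where
  | activate (i : Fin n) (x : Option In)
  | toAdv (msg : List Bool)

/-- What the environment gets back: a message of the adversary and, if a party was activated, the
output that this party produced, if any. -/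
structure Obs (Out : Type) where
  advMsg : List Bool
  out : Option Out

/-- An environment: it either acts or stops with a bit as its output. -/
structure Environment (n : ℕ) (In Out : Type) where
  State : Type
  init : State
  step : State → Option (Obs Out) → PMF (State × (EnvAction n In ⊕ Bool))

/-- A message on the channel from `src` to `dst`; `delay` is the number of further activations of
`dst` during which the channel still withholds it; `pending` says that it is not yet delivered. -/
structure Packet (n : ℕ) where
  src : Fin n
  dst : Fin n
  body : List Bool
  delay : ℕ
  pending : Bool

/-- What the adversary sees of a message: of a message between honest parties only its length. -/
structure PacketView (n : ℕ) where
  src : Fin n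
  dst : Fin n
  body : Option (List Bool)
  length : ℕ
  delay : ℕ
  pending : Bool

def Packet.view {n : ℕ} (Z : Finset (Fin n)) (p : Packet n) : PacketView n where
  src := p.src
  dst := p.dst
  body := if p.src ∈ Z ∨ p.dst ∈ Z then some p.body else none
  length := p.body.length
  delay := p.delay
  pending := p.pending

/-- Why the adversary is activated: a message of the environment, an honest party that has been
activated and is about to be served by its channels, or an activation of a corrupt party. -/
inductive AdvEvent (n : ℕ) (In : Type) where
  | env (msg : List Bool)
  | activated (i : Fin n)
  | corruptInput (i : Fin n) (x : Option In)

/-- Commands of the adversary: delay the `k`-th message by `T` more activations of its recipient, or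
send a message on behalf of a corrupt party. -/
inductive NetCmd (n : ℕ) where
  | delay (k T : ℕ)
  | inject (src dst : Fin n) (body : List Bool)

/-- A real-world adversary; it is started with the set of corrupt parties and an auxiliary input. Its
last output is its message to the environment. -/
structure Adversary (n : ℕ) (In : Type) where
  State : Type
  init : Finset (Fin n) → List Bool → State
  step : State → AdvEvent n In → List (PacketView n) → PMF (State × List (NetCmd n) × List Bool)

/-! ### Executions -/

/-- The output of the environment within its first `k` activations (`none`: it has not stopped), when
it interacts with a world whose reaction to the actions of the environment is `stepW`. -/
noncomputable def exec {n : ℕ} {In Out W : Type} (E : Environment n In Out)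
    (stepW : W → EnvAction n In → PMF (W × Obs Out)) :
    ℕ → E.State → Option (Obs Out) → W → PMF (Option Bool)
  | 0, _, _, _ => PMF.pure none
  | k + 1, e, o, w => (E.step e o).bind fun r =>
      match r with
      | (_, Sum.inr b) => PMF.pure (some b)
      | (e', Sum.inl a) => (stepW w a).bind fun q => exec E stepW k e' (some q.2) q.1

/-- `w` is a possible infinite evolution of a world from `w₀` under the environment actions `a`. -/
def IsRun {n : ℕ} {In Out W : Type} (stepW : W → EnvAction n In → PMF (W × Obs Out))
    (w₀ : W) (a : ℕ → EnvAction n In) (w : ℕ → W) : Prop :=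
  w 0 = w₀ ∧ ∀ k, ∃ o, (w (k + 1), o) ∈ (stepW (w k) (a k)).support

/-- Every honest party is activated infinitely often. -/
def IsFair {n : ℕ} {In : Type} (Z : Finset (Fin n)) (a : ℕ → EnvAction n In) : Prop :=
  ∀ i ∉ Z, ∃ᶠ k in Filter.atTop, ∃ x, a k = EnvAction.activate i x

/-! ### The asynchronous real world -/

structure RealWorld {n : ℕ} {In Out : Type} (Pr : Protocol n In Out) (A : Adversary n In) where
  adv : A.State
  party : Fin n → Pr.State
  net : List (Packet n)

def RealWorld.start {n : ℕ} {In Out : Type} (Pr : Protocol n In Out) (A : Adversary n In)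
    (Z : Finset (Fin n)) (z : List Bool) : RealWorld Pr A :=
  ⟨A.init Z z, Pr.init, []⟩

def NetCmd.apply {n : ℕ} (Z : Finset (Fin n)) (net : List (Packet n)) : NetCmd n → List (Packet n)
  | .delay k T => net.modify k fun p => { p with delay := p.delay + T }
  | .inject s d b => if s ∈ Z then net ++ [⟨s, d, b, 0, true⟩] else net

/-- The messages that the channels release to `i` at its present activation. -/
def released {n : ℕ} (i : Fin n) (net : List (Packet n)) : List (Fin n × List Bool) :=
  (net.filter fun p => decide (p.dst = i) && p.pending && decide (p.delay = 0)).map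
    fun p => (p.src, p.body)

/-- The channels after they have served an activation of `i`. -/
def afterFetch {n : ℕ} (i : Fin n) (net : List (Packet n)) : List (Packet n) :=
  net.map fun p =>
    if p.dst = i ∧ p.pending = true then
      if p.delay = 0 then { p with pending := false } else { p with delay := p.delay - 1 }
    else p

/-- The real world with corrupt set `Z` reacts to an action of the environment. If an honest party `i`
is activated, the adversary is told so first and may issue commands; then `i` receives the messages
that are due, computes and sends; then control returns to the environment. -/
noncomputable def realStep {n : ℕ} {In Out : Type} (Pr : Protocol n In Out) (A : Adversary n In)
    (Z : Finset (Fin n)) (w : RealWorld Pr A) :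
    EnvAction n In → PMF (RealWorld Pr A × Obs Out)
  | .toAdv msg =>
      (A.step w.adv (.env msg) (w.net.map (Packet.view Z))).bind fun r =>
        PMF.pure (⟨r.1, w.party, r.2.1.foldl (NetCmd.apply Z) w.net⟩, ⟨r.2.2, none⟩)
  | .activate i x =>
      if i ∈ Z then
        (A.step w.adv (.corruptInput i x) (w.net.map (Packet.view Z))).bind fun r =>
          PMF.pure (⟨r.1, w.party, r.2.1.foldl (NetCmd.apply Z) w.net⟩, ⟨r.2.2, none⟩)
      else
        (A.step w.adv (.activated i) (w.net.map (Packet.view Z))).bind fun r =>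
          let net := r.2.1.foldl (NetCmd.apply Z) w.net
          (Pr.step i (w.party i) x (released i net)).bind fun q =>
            PMF.pure
              (⟨r.1, Function.update w.party i q.1,
                afterFetch i net ++ q.2.1.map fun s => ⟨i, s.1, s.2, 0, true⟩⟩,
               ⟨r.2.2, q.2.2⟩)

/-- The distribution of the output of the environment in the real world. -/
noncomputable def REAL {n : ℕ} {In Out : Type} (Pr : Protocol n In Out) (A : Adversary n In)
    (z : List Bool) (Z : Finset (Fin n)) (E : Environment n In Out) (k : ℕ) : PMF (Option Bool) :=
  exec E (realStep Pr A Z) k E.init none (RealWorld.start Pr A Z z)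

/-- The adversary delays messages only finitely: if every honest party is activated again and again,
every message from an honest party to an honest party is eventually delivered. -/
def Adversary.EventualDelivery {n : ℕ} {In Out : Type} (𝒵 : Finset (Finset (Fin n)))
    (Pr : Protocol n In Out) (A : Adversary n In) : Prop :=
  ∀ (Z : Finset (Fin n)), Corruptible 𝒵 Z → ∀ (z : List Bool) (a : ℕ → EnvAction n In)
    (w : ℕ → RealWorld Pr A),
    IsRun (realStep Pr A Z) (RealWorld.start Pr A Z z) a w → IsFair Z a →
    ∀ (k m : ℕ) (p : Packet n), (w k).net[m]? = some p → p.src ∉ Z → p.dst ∉ Z →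
      ∃ k' p', (w k').net[m]? = some p' ∧ p'.pending = false

/-- The number of bits that the honest parties have sent so far. -/
def RealWorld.honestBits {n : ℕ} {In Out : Type} {Pr : Protocol n In Out} {A : Adversary n In}
    (Z : Finset (Fin n)) (w : RealWorld Pr A) : ℕ :=
  ((w.net.filter fun p => decide (p.src ∉ Z)).map fun p => p.body.length).sum

/-- In every execution the honest parties send at most `B` bits in total, whatever the environment
and the adversary do. -/
def Protocol.CommunicationAtMost {n : ℕ} {In Out : Type} (𝒵 : Finset (Finset (Fin n)))
    (Pr : Protocol n In Out) (B : ℕ) : Prop :=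
  ∀ (A : Adversary n In) (Z : Finset (Fin n)), Corruptible 𝒵 Z → ∀ (z : List Bool)
    (a : ℕ → EnvAction n In) (w : ℕ → RealWorld Pr A),
    IsRun (realStep Pr A Z) (RealWorld.start Pr A Z z) a w → ∀ k, (w k).honestBits Z ≤ B

/-! ### The asynchronous ideal world -/

/-- An ideal functionality with request-based delayed outputs. `input` handles the input of an honest
party (and possibly sends the simulator a message), `adv` a message of the simulator; both know the
set of corrupt parties. `output s i` is the output that is prepared for party `i`. -/
structure Functionality (n : ℕ) (In Out Leak AdvMsg : Type) where
  State : Type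
  init : State
  input : Finset (Fin n) → Fin n → In → State → State × Option Leak
  adv : Finset (Fin n) → AdvMsg → State → State
  output : State → Fin n → Option Out

/-- Why the simulator is activated: a message of the environment, an honest dummy party has been
activated (with the message, if any, that the functionality sends because of its input), or an
activation of a corrupt party. -/
inductive SimEvent (n : ℕ) (In Leak : Type) where
  | env (msg : List Bool)
  | activated (i : Fin n) (leak : Option Leak)
  | corruptInput (i : Fin n) (x : Option In)

/-- Commands of the simulator to the functionality: ignore the next `T` further requests that party
`i` makes while its output is prepared, or a message. -/
inductive FCmd (n : ℕ) (AdvMsg : Type) where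
  | delay (i : Fin n) (T : ℕ)
  | msg (m : AdvMsg)

/-- An ideal-world adversary. Its last output is its message to the environment. -/
structure Simulator (n : ℕ) (In Leak AdvMsg : Type) where
  State : Type
  init : Finset (Fin n) → List Bool → State
  step : State → SimEvent n In Leak → PMF (State × List (FCmd n AdvMsg) × List Bool)

/-- `delay i` is the number of further requests of `i` that are going to be ignored; `served` is the
set of parties that have obtained their output. -/
structure IdealWorld {n : ℕ} {In Out Leak AdvMsg : Type} (F : Functionality n In Out Leak AdvMsg)
    (S : Simulator n In Leak AdvMsg) where
  sim : S.State
  func : F.State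
  delay : Fin n → ℕ
  served : Finset (Fin n)

def IdealWorld.start {n : ℕ} {In Out Leak AdvMsg : Type} (F : Functionality n In Out Leak AdvMsg)
    (S : Simulator n In Leak AdvMsg) (Z : Finset (Fin n)) (z : List Bool) : IdealWorld F S :=
  ⟨S.init Z z, F.init, fun _ => 0, ∅⟩

def FCmd.apply {n : ℕ} {In Out Leak AdvMsg : Type} (F : Functionality n In Out Leak AdvMsg)
    (Z : Finset (Fin n)) (s : F.State × (Fin n → ℕ)) : FCmd n AdvMsg → F.State × (Fin n → ℕ)
  | .delay i T => (s.1, Function.update s.2 i (s.2 i + T))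
  | .msg m => (F.adv Z m s.1, s.2)

/-- The functionality answers the request of the honest party `i`. -/
def IdealWorld.serve {n : ℕ} {In Out Leak AdvMsg : Type} {F : Functionality n In Out Leak AdvMsg}
    {S : Simulator n In Leak AdvMsg} (w : IdealWorld F S) (i : Fin n) :
    IdealWorld F S × Option Out :=
  match F.output w.func i with
  | none => (w, none)
  | some y =>
      if i ∈ w.served then (w, none)
      else if w.delay i = 0 then ({ w with served := insert i w.served }, some y)
      else ({ w with delay := Function.update w.delay i (w.delay i - 1) }, none)

/-- The ideal world with corrupt set `Z` reacts to an action of the environment. An honest dummy party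
that is activated forwards its input, if any, to the functionality and requests its output; the
simulator is told about the activation and may issue commands; then the request is answered. -/
noncomputable def idealStep {n : ℕ} {In Out Leak AdvMsg : Type}
    (F : Functionality n In Out Leak AdvMsg) (S : Simulator n In Leak AdvMsg)
    (Z : Finset (Fin n)) (w : IdealWorld F S) :
    EnvAction n In → PMF (IdealWorld F S × Obs Out)
  | .toAdv msg =>
      (S.step w.sim (.env msg)).bind fun r =>
        let f := r.2.1.foldl (FCmd.apply F Z) (w.func, w.delay)
        PMF.pure (⟨r.1, f.1, f.2, w.served⟩, ⟨r.2.2, none⟩)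
  | .activate i x =>
      if i ∈ Z then
        (S.step w.sim (.corruptInput i x)).bind fun r =>
          let f := r.2.1.foldl (FCmd.apply F Z) (w.func, w.delay)
          PMF.pure (⟨r.1, f.1, f.2, w.served⟩, ⟨r.2.2, none⟩)
      else
        let g : F.State × Option Leak :=
          match x with
          | none => (w.func, none)
          | some v => F.input Z i v w.func
        (S.step w.sim (.activated i g.2)).bind fun r =>
          let f := r.2.1.foldl (FCmd.apply F Z) (g.1, w.delay)
          let u := (⟨r.1, f.1, f.2, w.served⟩ : IdealWorld F S).serve i
          PMF.pure (u.1, ⟨r.2.2, u.2⟩)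

/-- The distribution of the output of the environment in the ideal world. -/
noncomputable def IDEAL {n : ℕ} {In Out Leak AdvMsg : Type}
    (F : Functionality n In Out Leak AdvMsg) (S : Simulator n In Leak AdvMsg)
    (z : List Bool) (Z : Finset (Fin n)) (E : Environment n In Out) (k : ℕ) : PMF (Option Bool) :=
  exec E (idealStep F S Z) k E.init none (IdealWorld.start F S Z z)

/-- The simulator delays outputs only finitely: if every honest party is activated again and again,
every honest party for which an output is prepared eventually obtains it. -/
def Simulator.EventualDelivery {n : ℕ} {In Out Leak AdvMsg : Type} (𝒵 : Finset (Finset (Fin n)))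
    (F : Functionality n In Out Leak AdvMsg) (S : Simulator n In Leak AdvMsg) : Prop :=
  ∀ (Z : Finset (Fin n)), Corruptible 𝒵 Z → ∀ (z : List Bool) (a : ℕ → EnvAction n In)
    (w : ℕ → IdealWorld F S),
    IsRun (idealStep F S Z) (IdealWorld.start F S Z z) a w → IsFair Z a →
    ∀ (k : ℕ), ∀ i ∉ Z, F.output (w k).func i ≠ none → ∃ k', i ∈ (w k').served

/-! ### Running time of the simulator -/

/-- A finite-state control around one copy of the real-world execution: `input` determines the input
with which the virtual honest party is activated, `react` the commands to the functionality. -/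
structure SimControl (n : ℕ) (In Out Leak AdvMsg : Type) where
  Mem : Type
  finite : Finite Mem
  init : Finset (Fin n) → Mem
  input : Mem → Fin n → Option Leak → Option In
  react : Mem → Fin n → Option Leak → Option Out → Mem × List (FCmd n AdvMsg)

/-- The simulator with control `C` that runs `A` and virtual honest parties of `Pr`. At each of its
activations it advances the virtual execution by exactly one event, and it forwards the messages
between the environment and `A` unchanged. -/
noncomputable def SimControl.toSimulator {n : ℕ} {In Out Leak AdvMsg : Type}
    (C : SimControl n In Out Leak AdvMsg) (Pr : Protocol n In Out) (A : Adversary n In) :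
    Simulator n In Leak AdvMsg where
  State := RealWorld Pr A × Finset (Fin n) × C.Mem
  init Z z := (RealWorld.start Pr A Z z, Z, C.init Z)
  step s
    | .env msg => (realStep Pr A s.2.1 s.1 (.toAdv msg)).bind fun r =>
        PMF.pure ((r.1, s.2), [], r.2.advMsg)
    | .corruptInput i x => (realStep Pr A s.2.1 s.1 (.activate i x)).bind fun r =>
        PMF.pure ((r.1, s.2), [], r.2.advMsg)
    | .activated i l =>
        (realStep Pr A s.2.1 s.1 (.activate i (C.input s.2.2 i l))).bind fun r =>
          let c := C.react s.2.2 i l r.2.out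
          PMF.pure ((r.1, s.2.1, c.1), c.2, r.2.advMsg)

/-- `S` runs in time polynomial (even linear) in the running time of `A`: at each activation it
activates `A` exactly once and at most one party of `Pr` once, and apart from the bookkeeping of the
virtual channels it only has a finite control. -/
def Simulator.RunsInTimeOf {n : ℕ} {In Out Leak AdvMsg : Type} (Pr : Protocol n In Out)
    (A : Adversary n In) (S : Simulator n In Leak AdvMsg) : Prop :=
  ∃ C : SimControl n In Out Leak AdvMsg, S = C.toSimulator Pr A

/-! ### Perfect UC security -/

/-- `Pr` UC-securely realizes `F` with perfect security against static corruption of any set in the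
adversary structure `𝒵`: for every adversary there is a simulator, whose running time is bounded in
terms of that of the adversary and which delays only finitely if the adversary does, such that no
environment distinguishes the two worlds: its output has the same distribution in both. -/
def UCSecurelyRealizes {n : ℕ} {In Out Leak AdvMsg : Type} (𝒵 : Finset (Finset (Fin n)))
    (Pr : Protocol n In Out) (F : Functionality n In Out Leak AdvMsg) : Prop :=
  ∀ A : Adversary n In, ∃ S : Simulator n In Leak AdvMsg,
    S.RunsInTimeOf Pr A ∧
    (A.EventualDelivery 𝒵 Pr → S.EventualDelivery 𝒵 F) ∧
    ∀ (Z : Finset (Fin n)), Corruptible 𝒵 Z → ∀ (z : List Bool) (E : Environment n In Out) (k : ℕ),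
      REAL Pr A z Z E k = IDEAL F S z Z E k

/-! ### The functionality for asynchronous reliable broadcast -/

/-- The state is the message of the sender, once it is there. An honest sender supplies it itself, and
the functionality then passes it on to the simulator; for a corrupt sender the simulator supplies it.
The message is the output that is prepared for every party. -/
def FAcast {n : ℕ} (ℓ : ℕ) (sender : Fin n) :
    Functionality n (List.Vector Bool ℓ) (List.Vector Bool ℓ) (List.Vector Bool ℓ)
      (List.Vector Bool ℓ) where
  State := Option (List.Vector Bool ℓ)
  init := none
  input Z i m s := if i = sender ∧ i ∉ Z ∧ s = none then (some m, some m) else (s, none)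
  adv Z m s := if sender ∈ Z ∧ s = none then some m else s
  output s _ := s

/-! ### The echo/ready protocol -/

inductive Kind where
  | inp
  | echo
  | ready

/-- A message consists of a tag of two bits and `ℓ` bits of content. -/
def encode {ℓ : ℕ} (t : Kind) (m : List.Vector Bool ℓ) : List Bool :=
  match t with
  | .inp => false :: false :: m.toList
  | .echo => false :: true :: m.toList
  | .ready => true :: false :: m.toList

/-- Ill-formed strings are discarded. -/
def decode (ℓ : ℕ) : List Bool → Option (Kind × List.Vector Bool ℓ)
  | b :: c :: l =>
      if h : l.length = ℓ then
        match b, c with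
        | false, false => some (.inp, ⟨l, h⟩)
        | false, true => some (.echo, ⟨l, h⟩)
        | true, false => some (.ready, ⟨l, h⟩)
        | true, true => none
      else none
  | _ => none

/-- `started`, `echoed`, `readied`: the party has sent its `inp`, `echo`, `ready` message;
`finished`: it has produced its output; `echoes`, `readies`: the `echo` and `ready` messages that it
has received, with their senders. -/
structure AcastState (n ℓ : ℕ) where
  started : Bool
  echoed : Bool
  readied : Bool
  finished : Bool
  echoes : Finset (Fin n × List.Vector Bool ℓ)
  readies : Finset (Fin n × List.Vector Bool ℓ)

def AcastState.init (n ℓ : ℕ) : AcastState n ℓ := ⟨false, false, false, false, ∅, ∅⟩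

/-- The parties from which a message with content `m` has been received. -/
def sendersOf {n ℓ : ℕ} (R : Finset (Fin n × List.Vector Bool ℓ)) (m : List.Vector Bool ℓ) :
    Finset (Fin n) :=
  Finset.univ.filter fun j => (j, m) ∈ R

def sendAll {n ℓ : ℕ} (t : Kind) (m : List.Vector Bool ℓ) : List (Fin n × List Bool) :=
  (List.finRange n).map fun j => (j, encode t m)

/-- The state of a party during an activation, the messages it has sent in this activation so far, and
its output in this activation. -/
structure AcastLocal (n ℓ : ℕ) where
  st : AcastState n ℓ
  sent : List (Fin n × List Bool)
  out : Option (List.Vector Bool ℓ)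

/-- The sender distributes its input. -/
def acastInput {n ℓ : ℕ} (sender i : Fin n) (c : AcastLocal n ℓ) :
    Option (List.Vector Bool ℓ) → AcastLocal n ℓ
  | none => c
  | some m =>
      if i = sender ∧ c.st.started = false then
        { c with st := { c.st with started := true }, sent := c.sent ++ sendAll .inp m }
      else c

/-- Send `ready` for `m`, unless a `ready` message has been sent before. -/
def sendReady {n ℓ : ℕ} (c : AcastLocal n ℓ) (m : List.Vector Bool ℓ) : AcastLocal n ℓ :=
  if c.st.readied = false then
    { c with st := { c.st with readied := true }, sent := c.sent ++ sendAll .ready m }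
  else c

/-- Output `m`, unless an output has been produced before. -/
def giveOutput {n ℓ : ℕ} (c : AcastLocal n ℓ) (m : List.Vector Bool ℓ) : AcastLocal n ℓ :=
  if c.st.finished = false then
    { c with st := { c.st with finished := true }, out := some m }
  else c

/-- The reaction of a party to the string `r.2` received from party `r.1`. -/
def acastReceive {n ℓ : ℕ} (𝒵 : Finset (Finset (Fin n))) (sender : Fin n) (c : AcastLocal n ℓ)
    (r : Fin n × List Bool) : AcastLocal n ℓ :=
  match decode ℓ r.2 with
  | none => c
  | some (.inp, m) =>
      if r.1 = sender ∧ c.st.echoed = false then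
        { c with st := { c.st with echoed := true }, sent := c.sent ++ sendAll .echo m }
      else c
  | some (.echo, m) =>
      let c₁ := { c with st := { c.st with echoes := insert (r.1, m) c.st.echoes } }
      if IsQuorum 𝒵 (sendersOf c₁.st.echoes m) then sendReady c₁ m else c₁
  | some (.ready, m) =>
      let c₁ := { c with st := { c.st with readies := insert (r.1, m) c.st.readies } }
      let c₂ := if ¬ Corruptible 𝒵 (sendersOf c₁.st.readies m) then sendReady c₁ m else c₁
      if IsQuorum 𝒵 (sendersOf c₂.st.readies m) then giveOutput c₂ m else c₂

/-- One activation of party `i`. -/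
def acastActivation {n ℓ : ℕ} (𝒵 : Finset (Finset (Fin n))) (sender i : Fin n) (st : AcastState n ℓ)
    (x : Option (List.Vector Bool ℓ)) (recv : List (Fin n × List Bool)) : AcastLocal n ℓ :=
  recv.foldl (acastReceive 𝒵 sender) (acastInput sender i ⟨st, [], none⟩ x)

/-- The protocol; it is deterministic. -/
noncomputable def AcastProtocol {n : ℕ} (𝒵 : Finset (Finset (Fin n))) (ℓ : ℕ) (sender : Fin n) :
    Protocol n (List.Vector Bool ℓ) (List.Vector Bool ℓ) where
  State := AcastState n ℓ
  init _ := AcastState.init n ℓ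
  step i st x recv :=
    let c := acastActivation 𝒵 sender i st x recv
    PMF.pure (c.st, c.sent, c.out)

end AsyncUC

namespace AsyncUC

variable {n ℓ : ℕ}

/-! ### Encoding -/

/-! The simulator runs the adversary and the protocol internally, gives the leaked input of an
honest sender to the virtual sender, and lets the virtual outputs decide which requests are
answered. Since the protocol is deterministic, the answers of the adversary are the only randomness
of either world, and the same answers can drive both (`realStep_eq`, `idealStep_eq`,
`exec_eq_of_coupling`). It remains to see that for each answer the observations agree
(`IdealInv.next`): the functionality answers a party exactly when the virtual party outputs, and
with the same message.

This agreement is a safety property. By `Q 3`, the complements of two members of `𝒵` share an honest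
party (`Q.honest`), and an honest party echoes only once, so at most one message is backed by
echoes. Every honest `ready` is backed in this way: it stems from an echo quorum, or it is amplified
from a non-corruptible set, which contains an honest party with an earlier `ready`. Hence honest
`ready` messages and outputs agree (`WorldInv.ready_unique`, `WorldInv.output_unique`), and with an
honest sender they carry its input (`WorldInv.output_valid`). For a corrupt sender the first virtual
output fixes the message of the functionality.

Eventual delivery is a liveness property of the virtual execution, which is itself a real run. A
recorded message was either distributed by an honest sender, and then all honest parties echo it and
become ready, or it is backed by `ready` messages. In the latter case the honest parties behind it
form a non-corruptible set by `Q 3`, so all honest parties amplify. Either way the honest `ready`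
messages end up forming a quorum at every honest party. The argument needs that no rule is left
waiting between activations (`AcastState.Saturated`).

For the communication, each honest party sends at most three messages of `ℓ + 2` bits to each party;
the invariant counts them exactly. -/

theorem decode_encode (t : Kind) (m : List.Vector Bool ℓ) : decode ℓ (encode t m) = some (t, m) := by
  obtain ⟨l, hl⟩ := m
  cases t <;> simp [encode, decode, List.Vector.toList, hl]

/-- Links what a party parses to the traffic, which records raw strings. -/
theorem eq_encode_of_decode {l : List Bool} {t : Kind} {m : List.Vector Bool ℓ}
    (h : decode ℓ l = some (t, m)) : l = encode t m := by
  rcases l with _ | ⟨b, _ | ⟨c, l⟩⟩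
  · simp [decode] at h
  · simp [decode] at h
  · by_cases hl : l.length = ℓ
    · cases b <;> cases c <;> simp [decode, hl] at h <;> obtain ⟨rfl, rfl⟩ := h <;>
        simp [encode, List.Vector.toList]
    · simp [decode, hl] at h

theorem encode_inj {t t' : Kind} {m m' : List.Vector Bool ℓ} :
    encode t m = encode t' m' ↔ t = t' ∧ m = m' := by
  constructor
  · intro h
    have := decode_encode t m
    rw [h, decode_encode] at this
    simp at this
    exact ⟨this.1.symm, this.2.symm⟩
  · rintro ⟨rfl, rfl⟩; rfl

theorem length_encode (t : Kind) (m : List.Vector Bool ℓ) : (encode t m).length = ℓ + 2 := by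
  cases t <;> simp [encode]

theorem mem_sendAll {d : Fin n} {t t' : Kind} {m m' : List.Vector Bool ℓ} :
    (d, encode t' m') ∈ sendAll (n := n) t m ↔ t' = t ∧ m' = m := by
  simp [sendAll, encode_inj, eq_comm]

theorem sum_length_sendAll (t : Kind) (m : List.Vector Bool ℓ) :
    ((sendAll (n := n) t m).map fun s => s.2.length).sum = n * (ℓ + 2) := by
  simp [sendAll, Function.comp_def, length_encode]

/-! ### The state of a party -/

namespace AcastState

/-- Whether the message of kind `t` has been sent. -/
def flag (s : AcastState n ℓ) : Kind → Bool
  | .inp => s.started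
  | .echo => s.echoed
  | .ready => s.readied

def mark (s : AcastState n ℓ) : Kind → AcastState n ℓ
  | .inp => { s with started := true }
  | .echo => { s with echoed := true }
  | .ready => { s with readied := true }

theorem flag_mark (s : AcastState n ℓ) (t t' : Kind) :
    (s.mark t).flag t' = true ↔ t' = t ∨ s.flag t' = true := by
  cases t <;> cases t' <;> simp [mark, flag]

theorem echoes_mark (s : AcastState n ℓ) (t : Kind) : (s.mark t).echoes = s.echoes := by
  cases t <;> rfl

theorem readies_mark (s : AcastState n ℓ) (t : Kind) : (s.mark t).readies = s.readies := by
  cases t <;> rfl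

theorem finished_mark (s : AcastState n ℓ) (t : Kind) : (s.mark t).finished = s.finished := by
  cases t <;> rfl

/-- The number of messages that have been sent to each party. -/
def cost (s : AcastState n ℓ) : ℕ := s.started.toNat + s.echoed.toNat + s.readied.toNat

theorem cost_mark {s : AcastState n ℓ} {t : Kind} (h : s.flag t = false) :
    (s.mark t).cost = s.cost + 1 := by
  cases t <;> simp only [flag] at h <;> simp [cost, mark, h] <;> omega

theorem cost_le (s : AcastState n ℓ) : s.cost ≤ 3 := by
  have h (b : Bool) : b.toNat ≤ 1 := b.toNat_le
  have := h s.started; have := h s.echoed; have := h s.readied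
  unfold cost; omega

/-- `s'` may be a later state than `s`. -/
structure Le (s s' : AcastState n ℓ) : Prop where
  flag : ∀ t, s.flag t = true → s'.flag t = true
  finished : s.finished = true → s'.finished = true
  echoes : s.echoes ⊆ s'.echoes
  readies : s.readies ⊆ s'.readies

theorem Le.refl (s : AcastState n ℓ) : s.Le s := ⟨fun _ => id, id, subset_rfl, subset_rfl⟩

theorem Le.trans {s s' s'' : AcastState n ℓ} (h : s.Le s') (h' : s'.Le s'') : s.Le s'' :=
  ⟨fun t ht => h'.flag t (h.flag t ht), fun hf => h'.finished (h.finished hf),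
    h.echoes.trans h'.echoes, h.readies.trans h'.readies⟩

theorem le_mark (s : AcastState n ℓ) (t : Kind) : s.Le (s.mark t) :=
  ⟨fun t' h => (flag_mark s t t').2 (Or.inr h), by rw [finished_mark]; exact id,
    by rw [echoes_mark], by rw [readies_mark]⟩

/-- The party has processed the string `b` from party `j`. -/
structure Received (sender : Fin n) (s : AcastState n ℓ) (j : Fin n) (b : List Bool) : Prop where
  inp : j = sender → (∃ m : List.Vector Bool ℓ, b = encode .inp m) → s.flag .echo = true
  echo : ∀ m, b = encode .echo m → (j, m) ∈ s.echoes
  ready : ∀ m, b = encode .ready m → (j, m) ∈ s.readies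

theorem Received.mono {sender : Fin n} {s s' : AcastState n ℓ} {j : Fin n} {b : List Bool}
    (h : s.Received sender j b) (hs : s.Le s') : s'.Received sender j b :=
  ⟨fun hj hb => hs.flag _ (h.inp hj hb), fun m hm => hs.echoes (h.echo m hm),
    fun m hm => hs.readies (h.ready m hm)⟩

/-- No rule of the protocol is waiting to be applied. -/
structure Saturated (𝒵 : Finset (Finset (Fin n))) (s : AcastState n ℓ) : Prop where
  echo : ∀ m, IsQuorum 𝒵 (sendersOf s.echoes m) → s.readied = true
  amplify : ∀ m, ¬ Corruptible 𝒵 (sendersOf s.readies m) → s.readied = true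
  output : ∀ m, IsQuorum 𝒵 (sendersOf s.readies m) → s.finished = true

/-- No rule of the protocol is waiting to be applied, except possibly because of the `ready` messages
with content `m`. -/
structure SaturatedExcept (𝒵 : Finset (Finset (Fin n))) (s : AcastState n ℓ)
    (m : List.Vector Bool ℓ) : Prop where
  echo : ∀ m', IsQuorum 𝒵 (sendersOf s.echoes m') → s.readied = true
  amplify : ∀ m' ≠ m, ¬ Corruptible 𝒵 (sendersOf s.readies m') → s.readied = true
  output : ∀ m' ≠ m, IsQuorum 𝒵 (sendersOf s.readies m') → s.finished = true

end AcastState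

theorem mem_sendersOf {R : Finset (Fin n × List.Vector Bool ℓ)} {m : List.Vector Bool ℓ} {j : Fin n} :
    j ∈ sendersOf R m ↔ (j, m) ∈ R := by
  simp [sendersOf]

theorem sendersOf_insert_of_ne {R : Finset (Fin n × List.Vector Bool ℓ)}
    {m m' : List.Vector Bool ℓ} (h : m' ≠ m) (j : Fin n) :
    sendersOf (insert (j, m) R) m' = sendersOf R m' := by
  ext k; simp [mem_sendersOf, h]

/-- The third rule of the protocol, applied to `m`. -/
def amplify (𝒵 : Finset (Finset (Fin n))) (c : AcastLocal n ℓ) (m : List.Vector Bool ℓ) :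
    AcastLocal n ℓ :=
  if ¬ Corruptible 𝒵 (sendersOf c.st.readies m) then sendReady c m else c

/-- The fourth rule of the protocol, applied to `m`. -/
def settle (𝒵 : Finset (Finset (Fin n))) (c : AcastLocal n ℓ) (m : List.Vector Bool ℓ) :
    AcastLocal n ℓ :=
  if IsQuorum 𝒵 (sendersOf c.st.readies m) then giveOutput c m else c

/-- Separates the two rules that a `ready` message may trigger, so that each is analysed on its own.
-/
theorem acastReceive_ready {𝒵 : Finset (Finset (Fin n))} {sender : Fin n} {c : AcastLocal n ℓ}
    {j : Fin n} {b : List Bool} {m : List.Vector Bool ℓ} (hd : decode ℓ b = some (.ready, m)) :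
    acastReceive 𝒵 sender c (j, b) = settle 𝒵 (amplify 𝒵
      { c with st := { c.st with readies := insert (j, m) c.st.readies } } m) m := by
  unfold acastReceive
  simp only [hd]
  rfl

/-! ### Invariants of an activation -/

/-- All the honest parties outside some member of the adversary structure have sent `m` with tag `t`;
`G j t m` says that party `j` has done so. -/
def Backed (𝒵 : Finset (Finset (Fin n))) (Z : Finset (Fin n))
    (G : Fin n → Kind → List.Vector Bool ℓ → Prop) (t : Kind) (m : List.Vector Bool ℓ) : Prop :=
  ∃ Z' ∈ 𝒵, ∀ j ∉ Z, j ∉ Z' → G j t m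

theorem Backed.mono {𝒵 : Finset (Finset (Fin n))} {Z : Finset (Fin n)}
    {G G' : Fin n → Kind → List.Vector Bool ℓ → Prop} {t : Kind} {m : List.Vector Bool ℓ}
    (h : Backed 𝒵 Z G t m) (hG : ∀ j t m, G j t m → G' j t m) : Backed 𝒵 Z G' t m := by
  obtain ⟨Z', hZ', h⟩ := h
  exact ⟨Z', hZ', fun j hj hj' => hG _ _ _ (h j hj hj')⟩

/-- The relation between the state `s` of an honest party, the messages `S` that it has sent, and the
messages `G` that have been sent by all parties. -/
structure PartyInv (𝒵 : Finset (Finset (Fin n))) (sender : Fin n) (Z : Finset (Fin n))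
    (G : Fin n → Kind → List.Vector Bool ℓ → Prop) (S : Kind → List.Vector Bool ℓ → Prop)
    (s : AcastState n ℓ) : Prop where
  unique : ∀ t m m', S t m → S t m' → m = m'
  flag : ∀ t, s.flag t = true ↔ ∃ m, S t m
  echoes : ∀ j m, (j, m) ∈ s.echoes → j ∉ Z → G j .echo m
  readies : ∀ j m, (j, m) ∈ s.readies → j ∉ Z → G j .ready m
  echo : ∀ m, S .echo m → sender ∉ Z → G sender .inp m
  ready : ∀ m, S .ready m → Backed 𝒵 Z G .echo m
  saturated : s.Saturated 𝒵

theorem PartyInv.mono {𝒵 : Finset (Finset (Fin n))} {sender : Fin n} {Z : Finset (Fin n)}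
    {G G' : Fin n → Kind → List.Vector Bool ℓ → Prop} {S S' : Kind → List.Vector Bool ℓ → Prop}
    {s : AcastState n ℓ} (h : PartyInv 𝒵 sender Z G S s) (hG : ∀ j t m, G j t m → G' j t m)
    (hS : ∀ t m, S' t m ↔ S t m) : PartyInv 𝒵 sender Z G' S' s := by
  obtain rfl : S' = S := by ext t m; exact hS t m
  exact ⟨h.unique, h.flag, fun j m hm hj => hG _ _ _ (h.echoes j m hm hj),
    fun j m hm hj => hG _ _ _ (h.readies j m hm hj), fun m hm hs => hG _ _ _ (h.echo m hm hs),
    fun m hm => (h.ready m hm).mono hG, h.saturated⟩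

/-- Nothing is known about corrupt members of a quorum, so only its honest part is kept. -/
theorem IsQuorum.backed {𝒵 : Finset (Finset (Fin n))} {Z : Finset (Fin n)}
    {G : Fin n → Kind → List.Vector Bool ℓ → Prop} {t : Kind} {m : List.Vector Bool ℓ}
    {C : Finset (Fin n)} (h : IsQuorum 𝒵 C) (hC : ∀ j ∈ C, j ∉ Z → G j t m) :
    Backed 𝒵 Z G t m := by
  obtain ⟨Z', hZ', h⟩ := h
  exact ⟨Z', hZ', fun j hj hj' => hC j (h (by simp [hj'])) hj⟩

/-- The invariant of an activation of party `i` that started in the state `s₀`, when `G` had been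
sent; saturation is not included. -/
structure LocalInv (𝒵 : Finset (Finset (Fin n))) (sender : Fin n) (Z : Finset (Fin n))
    (G : Fin n → Kind → List.Vector Bool ℓ → Prop) (i : Fin n) (s₀ : AcastState n ℓ)
    (c : AcastLocal n ℓ) : Prop where
  le : s₀.Le c.st
  complete : ∀ d t (m : List.Vector Bool ℓ), (d, encode t m) ∈ c.sent → ∀ d', (d', encode t m) ∈ c.sent
  unique : ∀ t m m', (G i t m ∨ ∃ d, (d, encode t m) ∈ c.sent) →
    (G i t m' ∨ ∃ d, (d, encode t m') ∈ c.sent) → m = m'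
  flag : ∀ t, c.st.flag t = true ↔ ∃ m, G i t m ∨ ∃ d, (d, encode t m) ∈ c.sent
  echoes : ∀ j m, (j, m) ∈ c.st.echoes → j ∉ Z → G j .echo m
  readies : ∀ j m, (j, m) ∈ c.st.readies → j ∉ Z → G j .ready m
  echo : ∀ m, (G i .echo m ∨ ∃ d, (d, encode .echo m) ∈ c.sent) → sender ∉ Z → G sender .inp m
  ready : ∀ m, (G i .ready m ∨ ∃ d, (d, encode .ready m) ∈ c.sent) → Backed 𝒵 Z G .echo m
  out : ∀ m, c.out = some m → Backed 𝒵 Z G .ready m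
  finished : c.st.finished = (s₀.finished || c.out.isSome)
  once : s₀.finished = true → c.out = none
  cost : (c.sent.map fun s => s.2.length).sum + n * (ℓ + 2) * s₀.cost = n * (ℓ + 2) * c.st.cost

/-! ### The rules of the protocol preserve the activation invariant. -/

section Local

variable {𝒵 : Finset (Finset (Fin n))} {sender : Fin n} {Z : Finset (Fin n)}
  {G : Fin n → Kind → List.Vector Bool ℓ → Prop} {i : Fin n} {s₀ : AcastState n ℓ}
  {c : AcastLocal n ℓ}

theorem LocalInv.start (h : PartyInv 𝒵 sender Z G (G i) s₀) :
    LocalInv 𝒵 sender Z G i s₀ ⟨s₀, [], none⟩ where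
  le := .refl _
  complete := by simp
  unique := by simpa using h.unique
  flag := by simpa using h.flag
  echoes := h.echoes
  readies := h.readies
  echo := by simpa using h.echo
  ready := by simpa using h.ready
  out := by simp
  finished := by simp
  once := by simp
  cost := by simp

theorem LocalInv.partyInv (h : LocalInv 𝒵 sender Z G i s₀ c) (hs : c.st.Saturated 𝒵) :
    PartyInv 𝒵 sender Z G (fun t m => G i t m ∨ ∃ d, (d, encode t m) ∈ c.sent) c.st :=
  ⟨h.unique, h.flag, h.echoes, h.readies, h.echo, h.ready, hs⟩

/-- Treats the three kinds of message at once. The side conditions record where an `echo` or a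
`ready` comes from; an `inp` needs no justification. -/
theorem LocalInv.broadcast (h : LocalInv 𝒵 sender Z G i s₀ c) {t : Kind} {m : List.Vector Bool ℓ}
    (ht : c.st.flag t = false) (he : t = .echo → sender ∉ Z → G sender .inp m)
    (hr : t = .ready → Backed 𝒵 Z G .echo m) :
    LocalInv 𝒵 sender Z G i s₀ { c with st := c.st.mark t, sent := c.sent ++ sendAll t m } := by
  have key (t' m') : (G i t' m' ∨ ∃ d, (d, encode t' m') ∈ c.sent ++ sendAll t m) ↔
      (G i t' m' ∨ ∃ d, (d, encode t' m') ∈ c.sent) ∨ (t' = t ∧ m' = m) := by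
    simp only [List.mem_append, mem_sendAll]
    constructor
    · rintro (h | ⟨d, h | h⟩)
      · exact .inl (.inl h)
      · exact .inl (.inr ⟨d, h⟩)
      · exact .inr h
    · rintro ((h | ⟨d, h⟩) | h)
      · exact .inl h
      · exact .inr ⟨d, .inl h⟩
      · exact .inr ⟨i, .inr h⟩
  -- A clear flag means that nothing of kind `t` has been sent, so the new message has no
  -- competitor. This is what keeps messages unique.
  have hnot (m') : ¬ (G i t m' ∨ ∃ d, (d, encode t m') ∈ c.sent) := fun hm => by
    have := (h.flag t).2 ⟨m', hm⟩
    simp [ht] at this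
  refine ⟨h.le.trans (c.st.le_mark t), ?_, ?_, ?_, ?_, ?_, ?_, ?_, h.out, ?_, h.once, ?_⟩
  · intro d t' m' hm d'
    rcases List.mem_append.1 hm with hm | hm
    · exact List.mem_append.2 (.inl (h.complete _ _ _ hm d'))
    · exact List.mem_append.2 (.inr (mem_sendAll.2 (mem_sendAll.1 hm)))
  · intro t' m₁ m₂ h₁ h₂
    rw [key] at h₁ h₂
    rcases h₁ with h₁ | ⟨rfl, rfl⟩ <;> rcases h₂ with h₂ | ⟨h₂, h₂'⟩
    · exact h.unique _ _ _ h₁ h₂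
    · subst h₂; exact absurd h₁ (hnot _)
    · exact absurd h₂ (hnot _)
    · exact h₂'.symm
  · intro t'
    simp only [key, AcastState.flag_mark, h.flag t', exists_or]
    simp [or_comm]
  · simpa [AcastState.echoes_mark] using h.echoes
  · simpa [AcastState.readies_mark] using h.readies
  · intro m' hm'
    rw [key] at hm'
    rcases hm' with hm' | ⟨rfl, rfl⟩
    exacts [h.echo _ hm', he rfl]
  · intro m' hm'
    rw [key] at hm'
    rcases hm' with hm' | ⟨rfl, rfl⟩
    exacts [h.ready _ hm', hr rfl]
  · simpa [AcastState.finished_mark] using h.finished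
  · have := h.cost
    simp only [List.map_append, List.sum_append, sum_length_sendAll, AcastState.cost_mark ht]
    linarith

theorem LocalInv.sendReady (h : LocalInv 𝒵 sender Z G i s₀ c) {m : List.Vector Bool ℓ}
    (hr : Backed 𝒵 Z G .echo m) : LocalInv 𝒵 sender Z G i s₀ (sendReady c m) := by
  unfold AsyncUC.sendReady
  split_ifs with hc
  · exact h.broadcast (t := .ready) hc (by simp) (fun _ => hr)
  · exact h

theorem LocalInv.giveOutput (h : LocalInv 𝒵 sender Z G i s₀ c) {m : List.Vector Bool ℓ}
    (hr : Backed 𝒵 Z G .ready m) : LocalInv 𝒵 sender Z G i s₀ (giveOutput c m) := by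
  unfold AsyncUC.giveOutput
  split_ifs with hc
  -- Flags are never cleared, so the activation began unfinished and `once` holds vacuously.
  · have hf' : s₀.finished = false := Bool.eq_false_iff.2 fun hs => by
      rw [h.le.finished hs] at hc
      exact absurd hc (by simp)
    refine ⟨⟨h.le.flag, fun _ => rfl, h.le.echoes, h.le.readies⟩, h.complete, h.unique, h.flag,
      h.echoes, h.readies, h.echo, h.ready, ?_, (Bool.or_true _).symm,
      fun hs => absurd hs (by rw [hf']; exact Bool.false_ne_true), h.cost⟩
    intro m' hm'
    obtain rfl : m = m' := by simpa using hm'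
    exact hr
  · exact h

theorem LocalInv.insertEcho (h : LocalInv 𝒵 sender Z G i s₀ c) {j : Fin n}
    {m : List.Vector Bool ℓ} (hj : G j .echo m) :
    LocalInv 𝒵 sender Z G i s₀
      { c with st := { c.st with echoes := insert (j, m) c.st.echoes } } := by
  refine ⟨⟨h.le.flag, h.le.finished, h.le.echoes.trans (Finset.subset_insert _ _), h.le.readies⟩,
    h.complete, h.unique, h.flag, ?_, h.readies, h.echo, h.ready, h.out, h.finished, h.once, h.cost⟩
  intro k m' hk hkZ
  rcases Finset.mem_insert.1 hk with hk | hk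
  · obtain ⟨rfl, rfl⟩ := Prod.mk.inj hk
    exact hj
  · exact h.echoes _ _ hk hkZ

theorem LocalInv.insertReady (h : LocalInv 𝒵 sender Z G i s₀ c) {j : Fin n}
    {m : List.Vector Bool ℓ} (hj : G j .ready m) :
    LocalInv 𝒵 sender Z G i s₀
      { c with st := { c.st with readies := insert (j, m) c.st.readies } } := by
  refine ⟨⟨h.le.flag, h.le.finished, h.le.echoes, h.le.readies.trans (Finset.subset_insert _ _)⟩,
    h.complete, h.unique, h.flag, h.echoes, ?_, h.echo, h.ready, h.out, h.finished, h.once, h.cost⟩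
  intro k m' hk hkZ
  rcases Finset.mem_insert.1 hk with hk | hk
  · obtain ⟨rfl, rfl⟩ := Prod.mk.inj hk
    exact hj
  · exact h.readies _ _ hk hkZ

theorem LocalInv.input (h : LocalInv 𝒵 sender Z G i s₀ c) (x : Option (List.Vector Bool ℓ)) :
    LocalInv 𝒵 sender Z G i s₀ (acastInput sender i c x) := by
  rcases x with _ | m
  · exact h
  · simp only [acastInput]
    split_ifs with hc
    · exact h.broadcast (t := .inp) hc.2 (by simp) (by simp)
    · exact h

theorem sendReady_readies (c : AcastLocal n ℓ) (m : List.Vector Bool ℓ) :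
    (sendReady c m).st.readies = c.st.readies := by
  unfold sendReady; split_ifs <;> rfl

/-- `G` stays fixed during the activation, because whatever is sent now is delivered only later.
`hG` supplies the echo backing that the amplification rule inherits from an honest `ready`. -/
theorem LocalInv.receive (h : LocalInv 𝒵 sender Z G i s₀ c) (hZ : Corruptible 𝒵 Z)
    (hG : ∀ j ∉ Z, ∀ m, G j .ready m → Backed 𝒵 Z G .echo m) {r : Fin n × List Bool}
    (hr : ∀ t m, r.2 = encode t m → G r.1 t m) :
    LocalInv 𝒵 sender Z G i s₀ (acastReceive 𝒵 sender c r) := by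
  obtain ⟨j, b⟩ := r
  rcases hd : decode ℓ b with _ | ⟨_ | _ | _, m⟩
  · unfold acastReceive; simp only [hd]
    exact h
  · have hj : G j .inp m := hr _ _ (eq_encode_of_decode hd)
    unfold acastReceive; simp only [hd]
    split_ifs with hc
    · exact h.broadcast (t := .echo) hc.2 (fun _ _ => hc.1 ▸ hj) (by simp)
    · exact h
  · have h₁ := h.insertEcho (hr _ _ (eq_encode_of_decode hd) : G j .echo m)
    unfold acastReceive; simp only [hd]
    split_ifs with hc
    · exact h₁.sendReady (hc.backed fun k hk hkZ => h₁.echoes k m (mem_sendersOf.1 hk) hkZ)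
    · exact h₁
  · rw [acastReceive_ready hd]
    have h₁ := h.insertReady (hr _ _ (eq_encode_of_decode hd) : G j .ready m)
    generalize ({ c with st := { c.st with readies := insert (j, m) c.st.readies } } :
      AcastLocal n ℓ) = c₁ at h₁
    have h₂ : LocalInv 𝒵 sender Z G i s₀ (amplify 𝒵 c₁ m) := by
      unfold amplify
      split_ifs with hc
      · exact h₁
      · apply h₁.sendReady
        -- A non-corruptible set is not contained in `Z`, so it has an honest member, whose `ready`
        -- is already backed by echoes. Amplification thus never introduces a new message.
        have : ¬ sendersOf c₁.st.readies m ⊆ Z := fun hsub => by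
          obtain ⟨Z', hZ', hZZ'⟩ := hZ
          exact hc ⟨Z', hZ', hsub.trans hZZ'⟩
        obtain ⟨k, hk, hkZ⟩ := Finset.not_subset.1 this
        exact hG k hkZ m (h₁.readies k m (mem_sendersOf.1 hk) hkZ)
    generalize amplify 𝒵 c₁ m = c₂ at h₂
    unfold settle
    split_ifs with hc
    · exact h₂.giveOutput (hc.backed fun k hk hkZ => h₂.readies k m (mem_sendersOf.1 hk) hkZ)
    · exact h₂

/-! ### Monotonicity of the state and processing of received messages. -/

theorem le_sendReady (c : AcastLocal n ℓ) (m : List.Vector Bool ℓ) :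
    c.st.Le (sendReady c m).st := by
  unfold sendReady
  split_ifs
  · exact c.st.le_mark .ready
  · exact .refl _

theorem le_giveOutput (c : AcastLocal n ℓ) (m : List.Vector Bool ℓ) :
    c.st.Le (giveOutput c m).st := by
  unfold giveOutput
  split_ifs
  · exact ⟨fun _ => id, fun _ => rfl, subset_rfl, subset_rfl⟩
  · exact .refl _

theorem le_amplify (c : AcastLocal n ℓ) (m : List.Vector Bool ℓ) :
    c.st.Le (amplify 𝒵 c m).st := by
  unfold amplify
  split_ifs
  · exact .refl _
  · exact le_sendReady _ _

theorem le_settle (c : AcastLocal n ℓ) (m : List.Vector Bool ℓ) :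
    c.st.Le (settle 𝒵 c m).st := by
  unfold settle
  split_ifs
  · exact le_giveOutput _ _
  · exact .refl _

theorem le_acastReceive (c : AcastLocal n ℓ) (r : Fin n × List Bool) :
    c.st.Le (acastReceive 𝒵 sender c r).st ∧
      (acastReceive 𝒵 sender c r).st.Received sender r.1 r.2 := by
  obtain ⟨j, b⟩ := r
  rcases hd : decode ℓ b with _ | ⟨_ | _ | _, m⟩
  · unfold acastReceive; simp only [hd]
    refine ⟨.refl _, ?_, ?_, ?_⟩
    · rintro - ⟨m, rfl⟩; simp [decode_encode] at hd
    · rintro m rfl; simp [decode_encode] at hd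
    · rintro m rfl; simp [decode_encode] at hd
  · unfold acastReceive; simp only [hd]
    refine ⟨?_, ?_, ?_, ?_⟩
    · split_ifs
      · exact c.st.le_mark .echo
      · exact .refl _
    -- An `inp` that arrives after the first one is ignored, but then the echo flag is already set,
    -- and this is all that `Received` demands.
    · rintro rfl -
      split_ifs with hc
      · rfl
      · simpa [AcastState.flag] using hc
    · rintro m rfl; simp [decode_encode] at hd
    · rintro m rfl; simp [decode_encode] at hd
  · unfold acastReceive; simp only [hd]
    have h₁ : c.st.Le { c.st with echoes := insert (j, m) c.st.echoes } :=
      ⟨fun _ => id, id, Finset.subset_insert _ _, subset_rfl⟩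
    have h₂ : ({ c.st with echoes := insert (j, m) c.st.echoes } : AcastState n ℓ).Received
        sender j b := by
      refine ⟨?_, ?_, ?_⟩
      · rintro - ⟨m, rfl⟩; simp [decode_encode] at hd
      · rintro m' rfl
        obtain rfl : m' = m := by simpa [decode_encode] using hd
        simp
      · rintro m rfl; simp [decode_encode] at hd
    split_ifs
    · have h₃ := le_sendReady
        { c with st := { c.st with echoes := insert (j, m) c.st.echoes } } m
      exact ⟨h₁.trans h₃, h₂.mono h₃⟩
    · exact ⟨h₁, h₂⟩
  · rw [acastReceive_ready hd]
    have h₁ : c.st.Le { c.st with readies := insert (j, m) c.st.readies } :=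
      ⟨fun _ => id, id, subset_rfl, Finset.subset_insert _ _⟩
    have h₂ : ({ c.st with readies := insert (j, m) c.st.readies } : AcastState n ℓ).Received
        sender j b := by
      refine ⟨?_, ?_, ?_⟩
      · rintro - ⟨m, rfl⟩; simp [decode_encode] at hd
      · rintro m rfl; simp [decode_encode] at hd
      · rintro m' rfl
        obtain rfl : m' = m := by simpa [decode_encode] using hd
        simp
    have h₃ := (le_amplify (𝒵 := 𝒵)
      { c with st := { c.st with readies := insert (j, m) c.st.readies } } m).trans
      (le_settle (𝒵 := 𝒵) _ m)
    exact ⟨h₁.trans h₃, h₂.mono h₃⟩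

/-! ### Saturation: no applicable rule is left waiting. -/

theorem readied_sendReady (c : AcastLocal n ℓ) (m : List.Vector Bool ℓ) :
    (sendReady c m).st.readied = true := by
  unfold sendReady
  split_ifs with h
  · rfl
  · simpa using h

theorem finished_giveOutput (c : AcastLocal n ℓ) (m : List.Vector Bool ℓ) :
    (giveOutput c m).st.finished = true := by
  unfold giveOutput
  split_ifs with h
  · rfl
  · simpa using h

/-- Amplification leaves the received messages unchanged, and the output rule changes only
`finished`. Neither can therefore enable a rule for another message, and one pass suffices. -/
theorem saturated_settle {m : List.Vector Bool ℓ} (h : c.st.SaturatedExcept 𝒵 m) :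
    (settle 𝒵 (amplify 𝒵 c m) m).st.Saturated 𝒵 := by
  have h₂ : (amplify 𝒵 c m).st.SaturatedExcept 𝒵 m ∧
      (¬ Corruptible 𝒵 (sendersOf (amplify 𝒵 c m).st.readies m) →
        (amplify 𝒵 c m).st.readied = true) := by
    unfold amplify
    split_ifs with hc
    · exact ⟨h, fun h' => absurd hc h'⟩
    · refine ⟨⟨fun _ _ => readied_sendReady _ _, fun _ _ _ => readied_sendReady _ _, ?_⟩,
        fun _ => readied_sendReady _ _⟩
      rw [sendReady_readies]
      exact fun m' hm hq => (le_sendReady c m).finished (h.output m' hm hq)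
  generalize amplify 𝒵 c m = c₂ at h₂
  obtain ⟨h₂, h₃⟩ := h₂
  have ha (m') (hq : ¬ Corruptible 𝒵 (sendersOf c₂.st.readies m')) : c₂.st.readied = true := by
    by_cases hm : m' = m
    · subst hm; exact h₃ hq
    · exact h₂.amplify m' hm hq
  unfold settle
  split_ifs with hc
  · have e : (giveOutput c₂ m).st.readies = c₂.st.readies ∧
        (giveOutput c₂ m).st.echoes = c₂.st.echoes ∧
        (giveOutput c₂ m).st.readied = c₂.st.readied := by
      unfold giveOutput; split_ifs <;> simp
    refine ⟨?_, ?_, fun _ _ => finished_giveOutput _ _⟩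
    · rw [e.2.1, e.2.2]; exact h₂.echo
    · rw [e.1, e.2.2]; exact ha
  · refine ⟨h₂.echo, ha, fun m' hq => ?_⟩
    by_cases hm : m' = m
    · subst hm; exact absurd hq hc
    · exact h₂.output m' hm hq

theorem saturated_acastReceive (h : c.st.Saturated 𝒵) (r : Fin n × List Bool) :
    (acastReceive 𝒵 sender c r).st.Saturated 𝒵 := by
  obtain ⟨j, b⟩ := r
  rcases hd : decode ℓ b with _ | ⟨_ | _ | _, m⟩
  · unfold acastReceive; simp only [hd]
    exact h
  · unfold acastReceive; simp only [hd]
    split_ifs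
    · exact ⟨h.echo, h.amplify, h.output⟩
    · exact h
  · unfold acastReceive; simp only [hd]
    split_ifs with hc
    · have h₁ := le_sendReady { c with st := { c.st with echoes := insert (j, m) c.st.echoes } } m
      have h₂ := sendReady_readies
        { c with st := { c.st with echoes := insert (j, m) c.st.echoes } } m
      refine ⟨fun _ _ => readied_sendReady _ _, fun _ _ => readied_sendReady _ _, fun m' hm' => ?_⟩
      rw [h₂] at hm'
      exact h₁.finished (h.output m' hm')
    · refine ⟨fun m' hm' => ?_, h.amplify, h.output⟩
      -- Only the set of echoes for `m` has grown, and it is not a quorum.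
      by_cases hmm : m' = m
      · subst hmm; exact absurd hm' hc
      · dsimp only at hm'
        rw [sendersOf_insert_of_ne hmm] at hm'
        exact h.echo m' hm'
  · rw [acastReceive_ready hd]
    have h₁ : ({ c.st with readies := insert (j, m) c.st.readies } :
        AcastState n ℓ).SaturatedExcept 𝒵 m :=
      ⟨h.echo, fun m' hm hq => h.amplify m' (by simpa only [sendersOf_insert_of_ne hm] using hq),
        fun m' hm hq => h.output m' (by simpa only [sendersOf_insert_of_ne hm] using hq)⟩
    exact saturated_settle
      (c := { c with st := { c.st with readies := insert (j, m) c.st.readies } }) h₁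

theorem saturated_acastActivation {s : AcastState n ℓ} (h : s.Saturated 𝒵)
    (x : Option (List.Vector Bool ℓ)) (recv : List (Fin n × List Bool)) :
    (acastActivation 𝒵 sender i s x recv).st.Saturated 𝒵 := by
  unfold acastActivation
  apply List.foldlRecOn (motive := fun c : AcastLocal n ℓ => c.st.Saturated 𝒵)
  · rcases x with _ | m
    · exact h
    · simp only [acastInput]
      split_ifs
      · exact ⟨h.echo, h.amplify, h.output⟩
      · exact h
  · exact fun c hc r _ => saturated_acastReceive hc r

theorem received_foldl (recv : List (Fin n × List Bool)) (c : AcastLocal n ℓ) :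
    c.st.Le (recv.foldl (acastReceive 𝒵 sender) c).st ∧
      ∀ r ∈ recv, (recv.foldl (acastReceive 𝒵 sender) c).st.Received sender r.1 r.2 := by
  induction recv generalizing c with
  | nil => exact ⟨.refl _, by simp⟩
  | cons r l ih =>
    have h := le_acastReceive (𝒵 := 𝒵) (sender := sender) c r
    have h' := ih (acastReceive 𝒵 sender c r)
    refine ⟨h.1.trans h'.1, fun r' hr' => ?_⟩
    rcases List.mem_cons.1 hr' with rfl | hr'
    · exact h.2.mono h'.1
    · exact h'.2 r' hr'

theorem LocalInv.activation {s : AcastState n ℓ} (h : PartyInv 𝒵 sender Z G (G i) s)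
    (hZ : Corruptible 𝒵 Z) (hG : ∀ j ∉ Z, ∀ m, G j .ready m → Backed 𝒵 Z G .echo m)
    (x : Option (List.Vector Bool ℓ)) {recv : List (Fin n × List Bool)}
    (hr : ∀ r ∈ recv, ∀ t m, r.2 = encode t m → G r.1 t m) :
    LocalInv 𝒵 sender Z G i s (acastActivation 𝒵 sender i s x recv) := by
  unfold acastActivation
  apply List.foldlRecOn (motive := fun c : AcastLocal n ℓ => LocalInv 𝒵 sender Z G i s c)
  · exact (LocalInv.start h).input x
  · exact fun c hc r hrm => hc.receive hZ hG (hr r hrm)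

/-! ### When the sender distributes its input. -/

theorem mem_sent_sendReady {d : Fin n} {m m' : List.Vector Bool ℓ} :
    (d, encode .inp m) ∈ (sendReady c m').sent ↔ (d, encode .inp m) ∈ c.sent := by
  unfold sendReady
  split_ifs <;> simp [mem_sendAll]

theorem mem_sent_settle {d : Fin n} {m m' : List.Vector Bool ℓ} :
    (d, encode .inp m) ∈ (settle 𝒵 (amplify 𝒵 c m') m').sent ↔ (d, encode .inp m) ∈ c.sent := by
  have h₁ : (settle 𝒵 (amplify 𝒵 c m') m').sent = (amplify 𝒵 c m').sent := by
    unfold settle giveOutput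
    split_ifs <;> rfl
  rw [h₁]
  unfold amplify
  split_ifs
  · rfl
  · exact mem_sent_sendReady

theorem mem_sent_acastReceive {r : Fin n × List Bool} {d : Fin n} {m : List.Vector Bool ℓ} :
    (d, encode .inp m) ∈ (acastReceive 𝒵 sender c r).sent ↔ (d, encode .inp m) ∈ c.sent := by
  obtain ⟨j, b⟩ := r
  rcases hd : decode ℓ b with _ | ⟨_ | _ | _, m'⟩
  · unfold acastReceive; simp only [hd]
  · unfold acastReceive; simp only [hd]
    split_ifs <;> simp [mem_sendAll]
  · unfold acastReceive; simp only [hd]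
    split_ifs
    · exact mem_sent_sendReady
    · rfl
  · rw [acastReceive_ready hd, mem_sent_settle]

/-- Received strings never cause an `inp`, so the input and the flag `started` decide alone. This
matches the moment at which the functionality records an honest sender's message. -/
theorem mem_sent_acastActivation {s : AcastState n ℓ} {x : Option (List.Vector Bool ℓ)}
    {recv : List (Fin n × List Bool)} {d : Fin n} {m : List.Vector Bool ℓ} :
    (d, encode .inp m) ∈ (acastActivation 𝒵 sender i s x recv).sent ↔
      i = sender ∧ s.started = false ∧ x = some m := by
  have h (c : AcastLocal n ℓ) : (d, encode .inp m) ∈ (recv.foldl (acastReceive 𝒵 sender) c).sent ↔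
      (d, encode .inp m) ∈ c.sent := by
    induction recv generalizing c with
    | nil => rfl
    | cons r l ih => rw [List.foldl_cons, ih, mem_sent_acastReceive]
  rw [acastActivation, h]
  rcases x with _ | m'
  · simp [acastInput]
  · simp only [acastInput]
    split_ifs with hc
    · simp [mem_sendAll, hc, eq_comm]
    · have : ¬ (i = sender ∧ s.started = false ∧ some m' = some m) := fun h => hc ⟨h.1, h.2.1⟩
      simpa using this

end Local

/-! ### The traffic on the channels -/

/-- The senders, recipients and contents of all messages so far. -/
def traffic (net : List (Packet n)) : List (Fin n × Fin n × List Bool) :=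
  net.map fun p => (p.src, p.dst, p.body)

/-- Party `j` has sent the message `m` with tag `t`. -/
def Said (T : List (Fin n × Fin n × List Bool)) (j : Fin n) (t : Kind)
    (m : List.Vector Bool ℓ) : Prop :=
  ∃ d, (j, d, encode t m) ∈ T

/-- The messages that have been delivered. -/
def Delivered (net : List (Packet n)) (j d : Fin n) (b : List Bool) : Prop :=
  ∃ p ∈ net, p.src = j ∧ p.dst = d ∧ p.body = b ∧ p.pending = false

theorem traffic_append (l l' : List (Packet n)) : traffic (l ++ l') = traffic l ++ traffic l' :=
  List.map_append

theorem said_append {T L : List (Fin n × Fin n × List Bool)} {j : Fin n} {t : Kind}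
    {m : List.Vector Bool ℓ} : Said (T ++ L) j t m ↔ Said T j t m ∨ Said L j t m := by
  simp [Said, exists_or]

theorem delivered_append {l l' : List (Packet n)} {j d : Fin n} {b : List Bool} :
    Delivered (l ++ l') j d b ↔ Delivered l j d b ∨ Delivered l' j d b := by
  simp [Delivered, or_and_right, exists_or]

/-- Applied to projections that forget `delay`, for which delaying a packet is invisible. -/
theorem map_modify_of_comp_eq {α β : Type*} (g : α → β) {f : α → α} (h : ∀ a, g (f a) = g a)
    (l : List α) (k : ℕ) : (l.modify k f).map g = l.map g := by
  apply List.ext_getElem?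
  intro j
  simp only [List.getElem?_map, List.getElem?_modify]
  rcases l[j]? with _ | a
  · simp
  · by_cases hk : k = j <;> simp [hk, h]

theorem delivered_iff_mem_map {net : List (Packet n)} {j d : Fin n} {b : List Bool} :
    Delivered net j d b ↔
      (j, d, b, false) ∈ net.map fun p => (p.src, p.dst, p.body, p.pending) := by
  simp [Delivered]

/-- Channels are authenticated: the adversary can only append messages with a corrupt source, so
what honest parties have said is unaffected. -/
theorem NetCmd.traffic_apply (Z : Finset (Fin n)) (net : List (Packet n)) (cmd : NetCmd n) :
    ∃ L, traffic (cmd.apply Z net) = traffic net ++ L ∧ ∀ x ∈ L, x.1 ∈ Z := by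
  rcases cmd with ⟨k, T⟩ | ⟨s, d, b⟩
  · refine ⟨[], ?_, by simp⟩
    rw [List.append_nil]
    exact map_modify_of_comp_eq _ (f := fun p : Packet n => { p with delay := p.delay + T })
      (fun _ => rfl) _ _
  · by_cases hs : s ∈ Z
    · exact ⟨[(s, d, b)], by simp [NetCmd.apply, hs, traffic], by simpa using hs⟩
    · exact ⟨[], by simp [NetCmd.apply, hs], by simp⟩

theorem NetCmd.delivered_apply {Z : Finset (Fin n)} {net : List (Packet n)} {cmd : NetCmd n}
    {j d : Fin n} {b : List Bool} (h : Delivered (cmd.apply Z net) j d b) :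
    Delivered net j d b := by
  rcases cmd with ⟨k, T⟩ | ⟨s, d', b'⟩
  · rw [delivered_iff_mem_map] at h ⊢
    unfold NetCmd.apply at h
    rwa [map_modify_of_comp_eq] at h
    exact fun _ => rfl
  · simp only [NetCmd.apply] at h
    split_ifs at h
    · rcases delivered_append.1 h with h | h
      · exact h
      · simp [Delivered] at h
    · exact h

theorem traffic_commands (Z : Finset (Fin n)) (l : List (NetCmd n)) (net : List (Packet n)) :
    ∃ L, traffic (l.foldl (NetCmd.apply Z) net) = traffic net ++ L ∧ ∀ x ∈ L, x.1 ∈ Z := by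
  induction l generalizing net with
  | nil => exact ⟨[], by simp, by simp⟩
  | cons cmd l ih =>
    obtain ⟨L, hL, hL'⟩ := cmd.traffic_apply Z net
    obtain ⟨L₂, hL₂, hL₂'⟩ := ih (cmd.apply Z net)
    refine ⟨L ++ L₂, ?_, ?_⟩
    · rw [List.foldl_cons, hL₂, hL, List.append_assoc]
    · intro x hx
      exact (List.mem_append.1 hx).elim (hL' x) (hL₂' x)

theorem delivered_commands {Z : Finset (Fin n)} {l : List (NetCmd n)} {net : List (Packet n)}
    {j d : Fin n} {b : List Bool} (h : Delivered (l.foldl (NetCmd.apply Z) net) j d b) :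
    Delivered net j d b := by
  induction l generalizing net with
  | nil => exact h
  | cons cmd l ih => exact NetCmd.delivered_apply (ih h)

theorem traffic_afterFetch (i : Fin n) (net : List (Packet n)) :
    traffic (afterFetch i net) = traffic net := by
  unfold traffic afterFetch
  rw [List.map_map]
  refine List.map_congr_left fun p _ => ?_
  simp only [Function.comp]
  split_ifs <;> rfl

theorem delivered_afterFetch {i : Fin n} {net : List (Packet n)} {j d : Fin n} {b : List Bool}
    (h : Delivered (afterFetch i net) j d b) :
    Delivered net j d b ∨ d = i ∧ (j, b) ∈ released i net := by
  obtain ⟨p', hp', rfl, rfl, rfl, hpend⟩ := h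
  obtain ⟨p, hp, rfl⟩ := List.mem_map.1 hp'
  split_ifs at hpend ⊢ with h₁ h₂
  · right
    refine ⟨h₁.1, List.mem_map.2 ⟨p, List.mem_filter.2 ⟨hp, ?_⟩, rfl⟩⟩
    simp [h₁.1, h₁.2, h₂]
  · exact absurd h₁.2 (by simpa using hpend)
  · exact .inl ⟨p, hp, rfl, rfl, rfl, hpend⟩

theorem said_of_mem_released {i : Fin n} {net : List (Packet n)} {r : Fin n × List Bool}
    (h : r ∈ released i net) {t : Kind} {m : List.Vector Bool ℓ} (hr : r.2 = encode t m) :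
    Said (traffic net) r.1 t m := by
  obtain ⟨p, hp, rfl⟩ := List.mem_map.1 h
  exact ⟨p.dst, List.mem_map.2 ⟨p, (List.mem_filter.1 hp).1, by simpa using hr⟩⟩

/-- The messages with destinations `l`, sent by `i`. -/
def outgoing (i : Fin n) (l : List (Fin n × List Bool)) : List (Packet n) :=
  l.map fun s => ⟨i, s.1, s.2, 0, true⟩

theorem traffic_outgoing (i : Fin n) (l : List (Fin n × List Bool)) :
    traffic (outgoing i l) = l.map fun s => (i, s.1, s.2) := by
  simp [traffic, outgoing, Function.comp_def]

theorem mem_traffic_outgoing {i j d : Fin n} {l : List (Fin n × List Bool)} {b : List Bool} :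
    (j, d, b) ∈ traffic (outgoing i l) ↔ j = i ∧ (d, b) ∈ l := by
  rw [traffic_outgoing]
  simp [and_comm, eq_comm]

/-- The total length of the messages of honest parties. -/
def bitsOf (Z : Finset (Fin n)) (T : List (Fin n × Fin n × List Bool)) : ℕ :=
  ((T.filter fun x => decide (x.1 ∉ Z)).map fun x => x.2.2.length).sum

theorem bitsOf_append (Z : Finset (Fin n)) (T L : List (Fin n × Fin n × List Bool)) :
    bitsOf Z (T ++ L) = bitsOf Z T + bitsOf Z L := by
  simp [bitsOf]

theorem bitsOf_eq_zero {Z : Finset (Fin n)} {T : List (Fin n × Fin n × List Bool)}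
    (h : ∀ x ∈ T, x.1 ∈ Z) : bitsOf Z T = 0 := by
  have : T.filter (fun x => decide (x.1 ∉ Z)) = [] := by
    rw [List.filter_eq_nil_iff]
    intro x hx
    simpa using h x hx
  rw [bitsOf, this]
  rfl

theorem bitsOf_outgoing {Z : Finset (Fin n)} {i : Fin n} (hi : i ∉ Z)
    (l : List (Fin n × List Bool)) :
    bitsOf Z (traffic (outgoing i l)) = (l.map fun s => s.2.length).sum := by
  rw [traffic_outgoing]
  have : (l.map fun s => (i, s.1, s.2)).filter (fun x => decide (x.1 ∉ Z)) =
      l.map fun s => (i, s.1, s.2) := by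
    rw [List.filter_eq_self]
    intro x hx
    obtain ⟨s, -, rfl⟩ := List.mem_map.1 hx
    simpa using hi
  rw [bitsOf, this]
  simp [Function.comp_def]

/-! ### The invariant of the real world -/

/-- The invariant of the channels and the honest parties. -/
structure WorldInv (𝒵 : Finset (Finset (Fin n))) (sender : Fin n) (Z : Finset (Fin n))
    (net : List (Packet n)) (party : Fin n → AcastState n ℓ) : Prop where
  complete : ∀ j ∉ Z, ∀ d t (m : List.Vector Bool ℓ), (j, d, encode t m) ∈ traffic net →
    ∀ d', (j, d', encode t m) ∈ traffic net
  parties : ∀ i ∉ Z, PartyInv 𝒵 sender Z (Said (traffic net)) (Said (traffic net) i) (party i)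
  delivered : ∀ j d b, d ∉ Z → Delivered net j d b → (party d).Received sender j b
  bits : bitsOf Z (traffic net) = n * (ℓ + 2) * ∑ i ∈ Finset.univ \ Z, (party i).cost

section World

variable {𝒵 : Finset (Finset (Fin n))} {sender : Fin n} {Z : Finset (Fin n)}
  {net : List (Packet n)} {party : Fin n → AcastState n ℓ}

/-- Also used with repeated sets: `WorldInv.start` takes all three equal, to see that the empty set
is no quorum. -/
theorem Q.ne_univ (hQ : Q 3 Finset.univ 𝒵) {Z' Z₁ Z₂ : Finset (Fin n)} (h : Z' ∈ 𝒵) (h₁ : Z₁ ∈ 𝒵)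
    (h₂ : Z₂ ∈ 𝒵) : ∃ j, j ∉ Z' ∧ j ∉ Z₁ ∧ j ∉ Z₂ := by
  have := hQ ![Z', Z₁, Z₂] (by simp [Fin.forall_fin_succ, h, h₁, h₂])
  obtain ⟨j, -, hj⟩ := Finset.not_subset.1 this
  refine ⟨j, ?_⟩
  simpa [Fin.exists_fin_succ] using hj

theorem Q.honest (hQ : Q 3 Finset.univ 𝒵) (hZ : Corruptible 𝒵 Z) {Z₁ Z₂ : Finset (Fin n)}
    (h₁ : Z₁ ∈ 𝒵) (h₂ : Z₂ ∈ 𝒵) : ∃ j, j ∉ Z ∧ j ∉ Z₁ ∧ j ∉ Z₂ := by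
  obtain ⟨Z', hZ', hsub⟩ := hZ
  obtain ⟨j, hj, hj'⟩ := hQ.ne_univ hZ' h₁ h₂
  exact ⟨j, fun h => hj (hsub h), hj'⟩

theorem WorldInv.start (hQ : Q 3 Finset.univ 𝒵) (hZ : Corruptible 𝒵 Z) :
    WorldInv 𝒵 sender Z [] (fun _ => AcastState.init n ℓ) where
  complete := by simp [traffic]
  parties i hi := by
    -- Corruptibility of `Z` makes `𝒵` nonempty, so the empty set is corruptible and no
    -- amplification is pending at the start.
    obtain ⟨Z₀, hZ₀, -⟩ := hZ
    have hq : ¬ IsQuorum 𝒵 (∅ : Finset (Fin n)) := by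
      rintro ⟨Z', hZ', h⟩
      obtain ⟨j, hj, -⟩ := hQ.ne_univ hZ' hZ' hZ'
      simpa using h (by simpa using hj : j ∈ Finset.univ \ Z')
    refine ⟨by simp [Said, traffic], ?_, by simp [AcastState.init], by simp [AcastState.init],
      by simp [Said, traffic], by simp [Said, traffic], ?_⟩
    · intro t
      cases t <;> simp [Said, traffic, AcastState.flag, AcastState.init]
    · have he (m : List.Vector Bool ℓ) :
          sendersOf (∅ : Finset (Fin n × List.Vector Bool ℓ)) m = ∅ := by
        simp [sendersOf]
      refine ⟨fun m h => absurd h ?_, fun m h => absurd ⟨Z₀, hZ₀, ?_⟩ h, fun m h => absurd h ?_⟩ <;>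
        simp only [AcastState.init, he]
      exacts [hq, hq, Finset.empty_subset _]
  delivered := by simp [Delivered]
  bits := by simp [bitsOf, traffic, AcastState.cost, AcastState.init]

theorem WorldInv.commands (h : WorldInv 𝒵 sender Z net party) (l : List (NetCmd n)) :
    WorldInv 𝒵 sender Z (l.foldl (NetCmd.apply Z) net) party := by
  obtain ⟨L, hL, hLZ⟩ := traffic_commands Z l net
  have hnot {j : Fin n} (hj : j ∉ Z) (x) : (j, x) ∉ L := fun hx => hj (hLZ _ hx)
  refine ⟨?_, ?_, fun j d b hd hdel => h.delivered j d b hd (delivered_commands hdel), ?_⟩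
  · intro j hj d t m hm d'
    rw [hL, List.mem_append] at hm ⊢
    exact .inl (h.complete j hj d t m (hm.resolve_right (hnot hj _)) d')
  · intro i hi
    rw [hL]
    refine (h.parties i hi).mono (fun j t m hm => said_append.2 (.inl hm)) fun t m => ?_
    rw [said_append]
    exact or_iff_left fun ⟨d, hd⟩ => hnot hi _ hd
  · rw [hL, bitsOf_append, bitsOf_eq_zero hLZ, add_zero, h.bits]

/-- What an activation of an honest party does. -/
theorem WorldInv.localInv (h : WorldInv 𝒵 sender Z net party) (hZ : Corruptible 𝒵 Z) {i : Fin n}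
    (hi : i ∉ Z) (x : Option (List.Vector Bool ℓ)) :
    LocalInv 𝒵 sender Z (Said (traffic net)) i (party i)
      (acastActivation 𝒵 sender i (party i) x (released i net)) :=
  LocalInv.activation (h.parties i hi) hZ (fun j hj m hm => (h.parties j hj).ready m hm) x
    fun _ hr _ _ => said_of_mem_released hr

theorem WorldInv.activation (h : WorldInv 𝒵 sender Z net party) (hZ : Corruptible 𝒵 Z) {i : Fin n}
    (hi : i ∉ Z) (x : Option (List.Vector Bool ℓ)) {c : AcastLocal n ℓ}
    (hc : c = acastActivation 𝒵 sender i (party i) x (released i net)) :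
    WorldInv 𝒵 sender Z (afterFetch i net ++ outgoing i c.sent)
      (Function.update party i c.st) := by
  have hl := h.localInv hZ hi x
  rw [← hc] at hl
  have hsat : c.st.Saturated 𝒵 := hc ▸ saturated_acastActivation (h.parties i hi).saturated _ _
  have hT : traffic (afterFetch i net ++ outgoing i c.sent) =
      traffic net ++ traffic (outgoing i c.sent) := by
    rw [traffic_append, traffic_afterFetch]
  refine ⟨?_, ?_, ?_, ?_⟩
  · rw [hT]
    intro j hj d t m hm d'
    rw [List.mem_append, mem_traffic_outgoing] at hm ⊢
    rcases hm with hm | ⟨rfl, hm⟩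
    · exact .inl (h.complete j hj d t m hm d')
    · exact .inr ⟨rfl, hl.complete d t m hm d'⟩
  · rw [hT]
    intro j hj
    have hG (k : Fin n) (t : Kind) (m : List.Vector Bool ℓ) (hm : Said (traffic net) k t m) :
        Said (traffic net ++ traffic (outgoing i c.sent)) k t m := said_append.2 (.inl hm)
    by_cases hji : j = i
    · subst hji
      rw [Function.update_self]
      refine (hl.partyInv hsat).mono hG fun t m => ?_
      rw [said_append]
      simp [Said, mem_traffic_outgoing]
    · rw [Function.update_of_ne hji]
      refine (h.parties j hj).mono hG fun t m => ?_
      rw [said_append]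
      simp [Said, mem_traffic_outgoing, hji]
  · intro j d b hd hdel
    have hrec := received_foldl (𝒵 := 𝒵) (sender := sender) (released i net)
      (acastInput sender i ⟨party i, [], none⟩ x)
    have hle := hl.le
    rw [delivered_append] at hdel
    rcases hdel with hdel | hdel
    · rcases delivered_afterFetch hdel with hdel | ⟨rfl, hr⟩
      · have hold := h.delivered j d b hd hdel
        by_cases hdi : d = i
        · subst hdi
          rw [Function.update_self]
          exact hold.mono hle
        · rwa [Function.update_of_ne hdi]
      · rw [Function.update_self, hc]
        exact hrec.2 _ hr
    · simp [Delivered, outgoing] at hdel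
  · rw [hT, bitsOf_append, h.bits, bitsOf_outgoing hi]
    have hmem : i ∈ Finset.univ \ Z := by simpa using hi
    have hsum : ∑ j ∈ (Finset.univ \ Z).erase i, (Function.update party i c.st j).cost =
        ∑ j ∈ (Finset.univ \ Z).erase i, (party j).cost :=
      Finset.sum_congr rfl fun j hj => by rw [Function.update_of_ne (Finset.ne_of_mem_erase hj)]
    rw [← Finset.add_sum_erase _ _ hmem, ← Finset.add_sum_erase _ _ hmem, hsum,
      Function.update_self]
    linarith [hl.cost]

/-! ### Consistency -/

/-- The central use of `Q 3`: an honest party outside both exceptional sets has echoed both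
messages, and it echoes at most once. -/
theorem WorldInv.echo_unique (h : WorldInv 𝒵 sender Z net party) (hQ : Q 3 Finset.univ 𝒵)
    (hZ : Corruptible 𝒵 Z) {m m' : List.Vector Bool ℓ}
    (hm : Backed 𝒵 Z (Said (traffic net)) .echo m)
    (hm' : Backed 𝒵 Z (Said (traffic net)) .echo m') : m = m' := by
  obtain ⟨Z₁, hZ₁, h₁⟩ := hm
  obtain ⟨Z₂, hZ₂, h₂⟩ := hm'
  obtain ⟨j, hj, hj₁, hj₂⟩ := hQ.honest hZ hZ₁ hZ₂
  exact (h.parties j hj).unique _ _ _ (h₁ j hj hj₁) (h₂ j hj hj₂)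

theorem WorldInv.ready_unique (h : WorldInv 𝒵 sender Z net party) (hQ : Q 3 Finset.univ 𝒵)
    (hZ : Corruptible 𝒵 Z) {m m' : List.Vector Bool ℓ} {j j' : Fin n} (hj : j ∉ Z) (hj' : j' ∉ Z)
    (hm : Said (traffic net) j .ready m) (hm' : Said (traffic net) j' .ready m') : m = m' :=
  h.echo_unique hQ hZ ((h.parties j hj).ready m hm) ((h.parties j' hj').ready m' hm')

theorem WorldInv.exists_ready (hQ : Q 3 Finset.univ 𝒵) (hZ : Corruptible 𝒵 Z)
    {m : List.Vector Bool ℓ} {t : Kind} (hm : Backed 𝒵 Z (Said (traffic net)) t m) :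
    ∃ j ∉ Z, Said (traffic net) j t m := by
  obtain ⟨Z₁, hZ₁, h₁⟩ := hm
  obtain ⟨j, hj, hj₁, -⟩ := hQ.honest hZ hZ₁ hZ₁
  exact ⟨j, hj, h₁ j hj hj₁⟩

theorem WorldInv.output_unique (h : WorldInv 𝒵 sender Z net party) (hQ : Q 3 Finset.univ 𝒵)
    (hZ : Corruptible 𝒵 Z) {m m' : List.Vector Bool ℓ}
    (hm : Backed 𝒵 Z (Said (traffic net)) .ready m)
    (hm' : Backed 𝒵 Z (Said (traffic net)) .ready m') : m = m' := by
  obtain ⟨j, hj, hjm⟩ := WorldInv.exists_ready hQ hZ hm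
  obtain ⟨j', hj', hjm'⟩ := WorldInv.exists_ready hQ hZ hm'
  exact h.ready_unique hQ hZ hj hj' hjm hjm'

/-- An honest party is among the echoers behind the `ready`, and it echoes only what the sender
distributed. -/
theorem WorldInv.ready_valid (h : WorldInv 𝒵 sender Z net party) (hQ : Q 3 Finset.univ 𝒵)
    (hZ : Corruptible 𝒵 Z) (hs : sender ∉ Z) {m : List.Vector Bool ℓ} {j : Fin n} (hj : j ∉ Z)
    (hm : Said (traffic net) j .ready m) : Said (traffic net) sender .inp m := by
  obtain ⟨k, hk, hkm⟩ := WorldInv.exists_ready hQ hZ ((h.parties j hj).ready m hm)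
  exact (h.parties k hk).echo m hkm hs

theorem WorldInv.output_valid (h : WorldInv 𝒵 sender Z net party) (hQ : Q 3 Finset.univ 𝒵)
    (hZ : Corruptible 𝒵 Z) (hs : sender ∉ Z) {m : List.Vector Bool ℓ}
    (hm : Backed 𝒵 Z (Said (traffic net)) .ready m) : Said (traffic net) sender .inp m := by
  obtain ⟨j, hj, hjm⟩ := WorldInv.exists_ready hQ hZ hm
  exact h.ready_valid hQ hZ hs hj hjm

theorem WorldInv.bits_le (h : WorldInv 𝒵 sender Z net party) (hℓ : 1 ≤ ℓ) :
    bitsOf Z (traffic net) ≤ 9 * (n ^ 2 * ℓ) := by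
  have hsum : ∑ i ∈ Finset.univ \ Z, (party i).cost ≤ n * 3 := by
    calc _ ≤ ∑ i ∈ Finset.univ \ Z, 3 := Finset.sum_le_sum fun i _ => (party i).cost_le
      _ = (Finset.univ \ Z).card * 3 := by simp
      _ ≤ n * 3 := by
        gcongr
        simpa using Finset.card_le_univ (Finset.univ \ Z)
  rw [h.bits]
  -- One factor 3 is the number of messages per recipient; the other comes from `ℓ + 2 ≤ 3 * ℓ`,
  -- which needs `1 ≤ ℓ`.
  calc n * (ℓ + 2) * ∑ i ∈ Finset.univ \ Z, (party i).cost
      ≤ n * (ℓ + 2 * ℓ) * (n * 3) := by gcongr; omega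
    _ = 9 * (n ^ 2 * ℓ) := by ring

end World

/-! ### Steps of the real world -/

/-- What the adversary is told about an action of the environment. -/
def advEvent {In : Type} (Z : Finset (Fin n)) : EnvAction n In → AdvEvent n In
  | .toAdv msg => .env msg
  | .activate i x => if i ∈ Z then .corruptInput i x else .activated i

theorem AcastState.le_update {party : Fin n → AcastState n ℓ} {i : Fin n} {s : AcastState n ℓ}
    (h : (party i).Le s) (j : Fin n) : (party j).Le (Function.update party i s j) := by
  by_cases hji : j = i
  · subst hji
    rwa [Function.update_self]
  · rw [Function.update_of_ne hji]
    exact .refl _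

section Worlds

variable {𝒵 : Finset (Finset (Fin n))} {sender : Fin n} {A : Adversary n (List.Vector Bool ℓ)}
  {Z : Finset (Fin n)}

/-- The reaction of the real world when the adversary answers `r`. -/
def realNext (Z : Finset (Fin n)) (w : RealWorld (AcastProtocol 𝒵 ℓ sender) A)
    (a : EnvAction n (List.Vector Bool ℓ)) (r : A.State × List (NetCmd n) × List Bool) :
    RealWorld (AcastProtocol 𝒵 ℓ sender) A × Obs (List.Vector Bool ℓ) :=
  let net := r.2.1.foldl (NetCmd.apply Z) w.net
  match a with
  | .toAdv _ => (⟨r.1, w.party, net⟩, ⟨r.2.2, none⟩)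
  | .activate i x =>
      if i ∈ Z then (⟨r.1, w.party, net⟩, ⟨r.2.2, none⟩)
      else
        let c := acastActivation 𝒵 sender i (w.party i) x (released i net)
        (⟨r.1, Function.update w.party i c.st, afterFetch i net ++ outgoing i c.sent⟩,
          ⟨r.2.2, c.out⟩)

/-- The protocol is deterministic, so a step is the image of the distribution of the adversary's
answer. -/
theorem realStep_eq (w : RealWorld (AcastProtocol 𝒵 ℓ sender) A)
    (a : EnvAction n (List.Vector Bool ℓ)) :
    realStep (AcastProtocol 𝒵 ℓ sender) A Z w a =
      (A.step w.adv (advEvent Z a) (w.net.map (Packet.view Z))).map (realNext Z w a) := by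
  rcases a with ⟨i, x⟩ | msg
  · by_cases hi : i ∈ Z
    · simp only [realStep, advEvent, if_pos hi, PMF.map, Function.comp_def, realNext]
    · simp only [realStep, advEvent, if_neg hi, PMF.map, AcastProtocol, PMF.pure_bind]
      refine congrArg _ (funext fun r => ?_)
      simp only [Function.comp, realNext, if_neg hi]
      rfl
  · rfl

/-- The invariant of the real world. -/
abbrev RealInv (Z : Finset (Fin n)) (w : RealWorld (AcastProtocol 𝒵 ℓ sender) A) : Prop :=
  WorldInv 𝒵 sender Z w.net w.party

theorem RealInv.next {w : RealWorld (AcastProtocol 𝒵 ℓ sender) A} (h : RealInv Z w)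
    (hZ : Corruptible 𝒵 Z) (a : EnvAction n (List.Vector Bool ℓ))
    (r : A.State × List (NetCmd n) × List Bool) : RealInv Z (realNext Z w a r).1 := by
  rcases a with ⟨i, x⟩ | msg
  · by_cases hi : i ∈ Z
    · simp only [realNext, if_pos hi]
      exact h.commands _
    · simp only [realNext, if_neg hi]
      exact (h.commands r.2.1).activation hZ hi x rfl
  · exact h.commands _

/-- As the traffic only grows at its end, a position identifies the same message at all times. -/
theorem traffic_realNext (w : RealWorld (AcastProtocol 𝒵 ℓ sender) A)
    (a : EnvAction n (List.Vector Bool ℓ)) (r : A.State × List (NetCmd n) × List Bool) :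
    traffic w.net <+: traffic (realNext Z w a r).1.net := by
  have h : traffic w.net <+: traffic (r.2.1.foldl (NetCmd.apply Z) w.net) := by
    obtain ⟨L, hL, -⟩ := traffic_commands Z r.2.1 w.net
    exact ⟨L, hL.symm⟩
  rcases a with ⟨i, x⟩ | msg
  · by_cases hi : i ∈ Z
    · simp only [realNext, if_pos hi]
      exact h
    · simp only [realNext, if_neg hi]
      rw [traffic_append, traffic_afterFetch]
      exact h.trans (List.prefix_append _ _)
  · exact h

theorem RealInv.le {w : RealWorld (AcastProtocol 𝒵 ℓ sender) A} (h : RealInv Z w)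
    (hZ : Corruptible 𝒵 Z) (a : EnvAction n (List.Vector Bool ℓ))
    (r : A.State × List (NetCmd n) × List Bool) (j : Fin n) :
    AcastState.Le (w.party j) ((realNext Z w a r).1.party j) := by
  rcases a with ⟨i, x⟩ | msg
  · by_cases hi : i ∈ Z
    · simp only [realNext, if_pos hi]
      exact .refl _
    · simp only [realNext, if_neg hi]
      exact AcastState.le_update ((h.commands r.2.1).localInv hZ hi x).le j
  · exact .refl _

theorem RealWorld.honestBits_eq (w : RealWorld (AcastProtocol 𝒵 ℓ sender) A) :
    w.honestBits Z = bitsOf Z (traffic w.net) := by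
  simp [RealWorld.honestBits, bitsOf, traffic, List.filter_map, Function.comp_def]

/-! ### Infinite executions -/

section Run

variable {a : ℕ → EnvAction n (List.Vector Bool ℓ)} {z : List Bool}
  {w : ℕ → RealWorld (AcastProtocol 𝒵 ℓ sender) A}

theorem IsRun.exists_next
    (h : IsRun (realStep (AcastProtocol 𝒵 ℓ sender) A Z) (RealWorld.start _ A Z z) a w) (k : ℕ) :
    ∃ r, w (k + 1) = (realNext Z (w k) (a k) r).1 := by
  obtain ⟨o, ho⟩ := h.2 k
  rw [realStep_eq, PMF.mem_support_map_iff] at ho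
  obtain ⟨r, -, hr⟩ := ho
  exact ⟨r, by rw [hr]⟩

theorem IsRun.realInv
    (h : IsRun (realStep (AcastProtocol 𝒵 ℓ sender) A Z) (RealWorld.start _ A Z z) a w)
    (hQ : Q 3 Finset.univ 𝒵) (hZ : Corruptible 𝒵 Z) (k : ℕ) : RealInv Z (w k) := by
  induction k with
  | zero =>
    rw [h.1]
    exact WorldInv.start hQ hZ
  | succ k ih =>
    obtain ⟨r, hr⟩ := h.exists_next k
    rw [hr]
    exact ih.next hZ _ _

theorem IsRun.traffic_mono
    (h : IsRun (realStep (AcastProtocol 𝒵 ℓ sender) A Z) (RealWorld.start _ A Z z) a w)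
    {k k' : ℕ} (hk : k ≤ k') : traffic (w k).net <+: traffic (w k').net := by
  induction hk with
  | refl => exact List.prefix_rfl
  | step _ ih =>
    obtain ⟨r, hr⟩ := h.exists_next _
    rw [hr]
    exact ih.trans (traffic_realNext _ _ _)

theorem IsRun.party_mono
    (h : IsRun (realStep (AcastProtocol 𝒵 ℓ sender) A Z) (RealWorld.start _ A Z z) a w)
    (hQ : Q 3 Finset.univ 𝒵) (hZ : Corruptible 𝒵 Z) {k k' : ℕ} (hk : k ≤ k') (j : Fin n) :
    AcastState.Le ((w k).party j) ((w k').party j) := by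
  induction hk with
  | refl => exact .refl _
  | step _ ih =>
    obtain ⟨r, hr⟩ := h.exists_next _
    rw [hr]
    exact ih.trans ((h.realInv hQ hZ _).le hZ _ _ _)

theorem IsRun.said_mono
    (h : IsRun (realStep (AcastProtocol 𝒵 ℓ sender) A Z) (RealWorld.start _ A Z z) a w)
    {k k' : ℕ} (hk : k ≤ k') {j : Fin n} {t : Kind} {m : List.Vector Bool ℓ}
    (hm : Said (traffic (w k).net) j t m) : Said (traffic (w k').net) j t m := by
  obtain ⟨d, hd⟩ := hm
  exact ⟨d, (h.traffic_mono hk).subset hd⟩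

/-- What an honest party says to anyone it says to everyone, so some packet carries the message to
`i`. Once this packet is delivered it has been processed, and monotonicity makes that permanent. -/
theorem IsRun.eventually_received
    (h : IsRun (realStep (AcastProtocol 𝒵 ℓ sender) A Z) (RealWorld.start _ A Z z) a w)
    (hQ : Q 3 Finset.univ 𝒵) (hZ : Corruptible 𝒵 Z)
    (hdel : A.EventualDelivery 𝒵 (AcastProtocol 𝒵 ℓ sender)) (hfair : IsFair Z a) {i j : Fin n}
    (hi : i ∉ Z) (hj : j ∉ Z) {k : ℕ} {t : Kind} {m : List.Vector Bool ℓ}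
    (hm : Said (traffic (w k).net) j t m) :
    ∀ᶠ k' in Filter.atTop, AcastState.Received sender ((w k').party i) j (encode t m) := by
  obtain ⟨d, hd⟩ := hm
  have hd := (h.realInv hQ hZ k).complete j hj d t m hd i
  obtain ⟨idx, hidx⟩ := List.mem_iff_getElem?.1 hd
  have hidx' := hidx
  rw [traffic, List.getElem?_map, Option.map_eq_some_iff] at hidx'
  obtain ⟨p, hp, hpe⟩ := hidx'
  simp only [Prod.mk.injEq] at hpe
  obtain ⟨k', p', hp', hpend⟩ := hdel Z hZ z a w h hfair k idx p hp (hpe.1 ▸ hj) (hpe.2.1 ▸ hi)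
  have hidx'' : (traffic (w k').net)[idx]? = some (p'.src, p'.dst, p'.body) := by
    rw [traffic, List.getElem?_map, hp']; rfl
  have hpre {l l' : List (Fin n × Fin n × List Bool)} (hl : l <+: l') {x} (hx : l[idx]? = some x) :
      l'[idx]? = some x := by
    obtain ⟨L, rfl⟩ := hl
    rw [List.getElem?_append_left (List.getElem?_eq_some_iff.1 hx).1, hx]
  have he : (p'.src, p'.dst, p'.body) = (j, i, encode t m) := by
    -- The hypothesis does not say whether `k'` lies before or after `k`; position `idx` holds the
    -- same message in both cases.
    rcases le_total k k' with hkk | hkk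
    · exact Option.some.inj (hidx''.symm.trans (hpre (h.traffic_mono hkk) hidx))
    · exact Option.some.inj ((hpre (h.traffic_mono hkk) hidx'').symm.trans hidx)
  simp only [Prod.mk.injEq] at he
  have hrec := (h.realInv hQ hZ k').delivered j i (encode t m) hi
    ⟨p', List.mem_of_getElem? hp', he.1, he.2.1, he.2.2, hpend⟩
  filter_upwards [Filter.eventually_ge_atTop k'] with k'' hk''
  exact hrec.mono (h.party_mono hQ hZ hk'' i)

/-- If all honest parties have sent `ready` messages for `m`, all of them finish. -/
theorem IsRun.finished_of_ready
    (h : IsRun (realStep (AcastProtocol 𝒵 ℓ sender) A Z) (RealWorld.start _ A Z z) a w)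
    (hQ : Q 3 Finset.univ 𝒵) (hZ : Corruptible 𝒵 Z)
    (hdel : A.EventualDelivery 𝒵 (AcastProtocol 𝒵 ℓ sender)) (hfair : IsFair Z a)
    {m : List.Vector Bool ℓ}
    (hm : ∀ j ∉ Z, ∀ᶠ k in Filter.atTop, Said (traffic (w k).net) j .ready m)
    {i : Fin n} (hi : i ∉ Z) : ∃ k, AcastState.finished ((w k).party i) = true := by
  have hall : ∀ᶠ k in Filter.atTop, ∀ j, j ∉ Z →
      AcastState.Received sender ((w k).party i) j (encode .ready m) := by
    refine Filter.eventually_all.2 fun j => ?_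
    by_cases hj : j ∈ Z
    · exact .of_forall fun _ h => absurd hj h
    · obtain ⟨k, hk⟩ := (hm j hj).exists
      exact (h.eventually_received hQ hZ hdel hfair hi hj hk).mono fun _ h _ => h
  obtain ⟨k, hk⟩ := hall.exists
  obtain ⟨Z₀, hZ₀, hsub⟩ := hZ
  -- The honest parties include the complement of `Z₀`, so their `ready` messages form a quorum, and
  -- saturation turns this into an output.
  refine ⟨k, ((h.realInv hQ ⟨Z₀, hZ₀, hsub⟩ k).parties i hi).saturated.output m ⟨Z₀, hZ₀, ?_⟩⟩
  intro j hj
  have hj : j ∉ Z := fun h => by simp [hsub h] at hj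
  exact mem_sendersOf.2 ((hk j hj).ready m rfl)

/-- Totality: by `Q 3` the honest parties outside `Z'` form a non-corruptible set, so their `ready`
messages make every honest party amplify. -/
theorem IsRun.eventually_ready_of_backed
    (h : IsRun (realStep (AcastProtocol 𝒵 ℓ sender) A Z) (RealWorld.start _ A Z z) a w)
    (hQ : Q 3 Finset.univ 𝒵) (hZ : Corruptible 𝒵 Z)
    (hdel : A.EventualDelivery 𝒵 (AcastProtocol 𝒵 ℓ sender)) (hfair : IsFair Z a) {k : ℕ}
    {m : List.Vector Bool ℓ} (hm : Backed 𝒵 Z (Said (traffic (w k).net)) .ready m)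
    {i : Fin n} (hi : i ∉ Z) : ∀ᶠ k in Filter.atTop, Said (traffic (w k).net) i .ready m := by
  obtain ⟨j₀, hj₀, hjm⟩ := WorldInv.exists_ready hQ hZ hm
  obtain ⟨Z', hZ', hm⟩ := hm
  have hall : ∀ᶠ k in Filter.atTop, ∀ j, j ∉ Z → j ∉ Z' →
      AcastState.Received sender ((w k).party i) j (encode .ready m) := by
    refine Filter.eventually_all.2 fun j => ?_
    by_cases hj : j ∈ Z
    · exact .of_forall fun _ h => absurd hj h
    · by_cases hj' : j ∈ Z'
      · exact .of_forall fun _ _ h => absurd hj' h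
      · exact (h.eventually_received hQ hZ hdel hfair hi hj (hm j hj hj')).mono fun _ h _ _ => h
  filter_upwards [hall, Filter.eventually_ge_atTop k] with k' hk' hkk'
  have hinv := h.realInv hQ hZ k'
  have hready : AcastState.flag ((w k').party i) .ready = true := by
    refine (hinv.parties i hi).saturated.amplify m ?_
    rintro ⟨Z₂, hZ₂, hsub⟩
    obtain ⟨j, hj, hj', hj₂⟩ := hQ.honest hZ hZ' hZ₂
    exact hj₂ (hsub (mem_sendersOf.2 ((hk' j hj hj').ready m rfl)))
  -- The flag only shows that some `ready` was sent; agreement of honest `ready` messages identifies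
  -- its content.
  obtain ⟨m', hm'⟩ := ((hinv.parties i hi).flag .ready).1 hready
  obtain rfl := hinv.ready_unique hQ hZ hi hj₀ hm' (h.said_mono hkk' hjm)
  exact hm'

/-- Liveness for an honest sender: its unique `inp` makes all honest parties echo `m`, and these
echoes are a quorum. -/
theorem IsRun.eventually_ready_of_input
    (h : IsRun (realStep (AcastProtocol 𝒵 ℓ sender) A Z) (RealWorld.start _ A Z z) a w)
    (hQ : Q 3 Finset.univ 𝒵) (hZ : Corruptible 𝒵 Z)
    (hdel : A.EventualDelivery 𝒵 (AcastProtocol 𝒵 ℓ sender)) (hfair : IsFair Z a) {k : ℕ}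
    {m : List.Vector Bool ℓ} (hs : sender ∉ Z) (hm : Said (traffic (w k).net) sender .inp m)
    {i : Fin n} (hi : i ∉ Z) : ∀ᶠ k in Filter.atTop, Said (traffic (w k).net) i .ready m := by
  have hinp {k' : ℕ} (hk : k ≤ k') {m' : List.Vector Bool ℓ}
      (hm' : Said (traffic (w k').net) sender .inp m') : m' = m :=
    ((h.realInv hQ hZ k').parties sender hs).unique _ _ _ hm' (h.said_mono hk hm)
  have hecho (j : Fin n) (hj : j ∉ Z) :
      ∀ᶠ k' in Filter.atTop, Said (traffic (w k').net) j .echo m := by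
    filter_upwards [h.eventually_received hQ hZ hdel hfair hj hs hm,
      Filter.eventually_ge_atTop k] with k' hk' hkk'
    have hinv := (h.realInv hQ hZ k').parties j hj
    obtain ⟨m', hm'⟩ := (hinv.flag .echo).1 (hk'.inp rfl ⟨m, rfl⟩)
    obtain rfl := hinp hkk' (hinv.echo m' hm' hs)
    exact hm'
  have hall : ∀ᶠ k in Filter.atTop, ∀ j, j ∉ Z →
      AcastState.Received sender ((w k).party i) j (encode .echo m) := by
    refine Filter.eventually_all.2 fun j => ?_
    by_cases hj : j ∈ Z
    · exact .of_forall fun _ h => absurd hj h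
    · obtain ⟨k, hk⟩ := (hecho j hj).exists
      exact (h.eventually_received hQ hZ hdel hfair hi hj hk).mono fun _ h _ => h
  filter_upwards [hall, Filter.eventually_ge_atTop k] with k' hk' hkk'
  have hinv := h.realInv hQ hZ k'
  have hready : AcastState.flag ((w k').party i) .ready = true := by
    obtain ⟨Z₀, hZ₀, hsub⟩ := hZ
    refine (hinv.parties i hi).saturated.echo m ⟨Z₀, hZ₀, fun j hj => ?_⟩
    have hj : j ∉ Z := fun h => by simp [hsub h] at hj
    exact mem_sendersOf.2 ((hk' j hj).echo m rfl)
  obtain ⟨m', hm'⟩ := ((hinv.parties i hi).flag .ready).1 hready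
  obtain rfl := hinp hkk' (hinv.ready_valid hQ hZ hs hi hm')
  exact hm'

end Run

/-! ### The simulator -/

/-- The virtual sender gets the message that the functionality passes on. When a virtual honest party
produces an output, the functionality is told so; when it does not although an output is prepared, the
present request is ignored. The memory says whether an output is prepared. -/
def acastControl (n ℓ : ℕ) : SimControl n (List.Vector Bool ℓ) (List.Vector Bool ℓ)
    (List.Vector Bool ℓ) (List.Vector Bool ℓ) where
  Mem := Bool
  finite := inferInstance
  init _ := false
  input _ _ l := l
  react b i l o := (b || l.isSome || o.isSome,
    match o with
    | some m => [.msg m]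
    | none => if b || l.isSome then [.delay i 1] else [])

variable (𝒵 sender A) in
/-- The simulator for the adversary `A`. -/
noncomputable abbrev acastSim : Simulator n (List.Vector Bool ℓ) (List.Vector Bool ℓ)
    (List.Vector Bool ℓ) :=
  (acastControl n ℓ).toSimulator (AcastProtocol 𝒵 ℓ sender) A

/-- The invariant of the ideal world. -/
structure IdealInv (Z : Finset (Fin n)) (v : RealWorld (AcastProtocol 𝒵 ℓ sender) A)
    (w : IdealWorld (FAcast ℓ sender) (acastSim 𝒵 sender A)) : Prop where
  sim : w.sim.1 = v
  corrupt : w.sim.2.1 = Z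
  mem : w.sim.2.2 = Option.isSome (α := List.Vector Bool ℓ) w.func
  real : RealInv Z v
  served : ∀ i ∉ Z, i ∈ w.served ↔ AcastState.finished (v.party i) = true
  delay : ∀ i ∉ Z, i ∉ w.served → w.delay i = 0
  honest : sender ∉ Z → ∀ m, w.func = some m ↔ Said (traffic v.net) sender .inp m
  backed : sender ∈ Z → ∀ m, w.func = some m → Backed 𝒵 Z (Said (traffic v.net)) .ready m

theorem IdealInv.start (hQ : Q 3 Finset.univ 𝒵) (hZ : Corruptible 𝒵 Z) (z : List Bool) :
    IdealInv Z (RealWorld.start (AcastProtocol 𝒵 ℓ sender) A Z z)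
      (IdealWorld.start (FAcast ℓ sender) (acastSim 𝒵 sender A) Z z) where
  sim := rfl
  corrupt := rfl
  mem := rfl
  real := WorldInv.start hQ hZ
  served i _ := by
    simp [IdealWorld.start, RealWorld.start, AcastProtocol, AcastState.init]
  delay _ _ _ := rfl
  honest _ m := by simp [IdealWorld.start, FAcast, RealWorld.start, traffic, Said]
  backed _ m hm := by simp [IdealWorld.start, FAcast] at hm

/-- The invariant survives commands of the adversary to the channels. -/
theorem IdealInv.commands {v : RealWorld (AcastProtocol 𝒵 ℓ sender) A}
    {w : IdealWorld (FAcast ℓ sender) (acastSim 𝒵 sender A)} (h : IdealInv Z v w)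
    (r : A.State × List (NetCmd n) × List Bool) :
    IdealInv Z ⟨r.1, v.party, r.2.1.foldl (NetCmd.apply Z) v.net⟩
      ⟨(⟨r.1, v.party, r.2.1.foldl (NetCmd.apply Z) v.net⟩, w.sim.2), w.func, w.delay,
        w.served⟩ := by
  obtain ⟨L, hL, hLZ⟩ := traffic_commands Z r.2.1 v.net
  refine ⟨rfl, h.corrupt, h.mem, h.real.commands _, h.served, h.delay, fun hs m => ?_,
    fun hs m hm => ?_⟩
  · change w.func = some m ↔ Said (traffic (r.2.1.foldl (NetCmd.apply Z) v.net)) sender .inp m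
    rw [hL, said_append, h.honest hs m]
    exact (or_iff_left fun ⟨d, hd⟩ => hs (hLZ _ hd)).symm
  · change Backed 𝒵 Z (Said (traffic (r.2.1.foldl (NetCmd.apply Z) v.net))) .ready m
    rw [hL]
    exact (h.backed hs m hm).mono fun _ _ _ hx => said_append.2 (.inl hx)

end Worlds

/-- Two worlds that react to the same randomness with the same observations cannot be distinguished. -/
theorem exec_eq_of_coupling {In Out W W' : Type} (E : Environment n In Out)
    {stepW : W → EnvAction n In → PMF (W × Obs Out)}
    {stepW' : W' → EnvAction n In → PMF (W' × Obs Out)} (R : W → W' → Prop)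
    (h : ∀ w w', R w w' → ∀ a, ∃ (α : Type) (p : PMF α) (f : α → W × Obs Out)
      (f' : α → W' × Obs Out), stepW w a = p.map f ∧ stepW' w' a = p.map f' ∧
        ∀ r, (f r).2 = (f' r).2 ∧ R (f r).1 (f' r).1)
    (k : ℕ) (e : E.State) (o : Option (Obs Out)) {w : W} {w' : W'} (hw : R w w') :
    exec E stepW k e o w = exec E stepW' k e o w' := by
  induction k generalizing e o w w' with
  | zero => rfl
  | succ k ih =>
    simp only [exec]
    refine congrArg _ (funext fun r => ?_)
    rcases r with ⟨e', a | b⟩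
    · obtain ⟨α, p, f, f', hf, hf', hff⟩ := h w w' hw a
      simp only [hf, hf', PMF.bind_map]
      refine congrArg _ (funext fun r => ?_)
      simp only [Function.comp, (hff r).1]
      exact ih _ _ (hff r).2
    · rfl

/-! ### The coupling of the real and the ideal execution. -/

section Ideal

variable {𝒵 : Finset (Finset (Fin n))} {sender : Fin n} {A : Adversary n (List.Vector Bool ℓ)}
  {Z : Finset (Fin n)}

/-- The answer of the functionality to the input `x` of the honest party `i`. -/
def acastForward (sender : Fin n) (Z : Finset (Fin n)) (i : Fin n)
    (x s : Option (List.Vector Bool ℓ)) :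
    Option (List.Vector Bool ℓ) × Option (List.Vector Bool ℓ) :=
  match x with
  | none => (s, none)
  | some v => (FAcast ℓ sender).input Z i v s

theorem acastForward_of_first {i : Fin n} {x : Option (List.Vector Bool ℓ)} (hi : i ∉ Z)
    (h : i = sender) : acastForward sender Z i x none = (x, x) := by
  rcases x with _ | v
  · rfl
  · simp only [acastForward, FAcast]
    rw [if_pos ⟨h, hi, trivial⟩]

theorem acastForward_of_not_first {i : Fin n} {x s : Option (List.Vector Bool ℓ)}
    (h : ¬ (i = sender ∧ s = none)) : acastForward sender Z i x s = (s, none) := by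
  rcases x with _ | v
  · rfl
  · simp only [acastForward, FAcast]
    rw [if_neg fun h' => h ⟨h'.1, h'.2.2⟩]

/-- Ideal world after the simulator has reacted to an activation of the honest party `i`; `v` is the
virtual world, `o` the virtual output of `i`, and `g` the answer of the functionality to the input. -/
noncomputable def afterReact (Z : Finset (Fin n)) (w : IdealWorld (FAcast ℓ sender) (acastSim 𝒵 sender A))
    (i : Fin n) (g : Option (List.Vector Bool ℓ) × Option (List.Vector Bool ℓ))
    (v : RealWorld (AcastProtocol 𝒵 ℓ sender) A) (o : Option (List.Vector Bool ℓ)) :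
    IdealWorld (FAcast ℓ sender) (acastSim 𝒵 sender A) :=
  let c := (acastControl n ℓ).react w.sim.2.2 i g.2 o
  let f := c.2.foldl (FCmd.apply (FAcast ℓ sender) Z) (g.1, w.delay)
  ⟨(v, w.sim.2.1, c.1), f.1, f.2, w.served⟩

/-- The reaction of the ideal world when the adversary answers `r` to the simulator. -/
noncomputable def idealNext (Z : Finset (Fin n)) (w : IdealWorld (FAcast ℓ sender) (acastSim 𝒵 sender A))
    (a : EnvAction n (List.Vector Bool ℓ)) (r : A.State × List (NetCmd n) × List Bool) :
    IdealWorld (FAcast ℓ sender) (acastSim 𝒵 sender A) × Obs (List.Vector Bool ℓ) :=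
  match a with
  | .toAdv _ => (⟨((realNext Z w.sim.1 a r).1, w.sim.2), w.func, w.delay, w.served⟩, ⟨r.2.2, none⟩)
  | .activate i x =>
      if i ∈ Z then
        (⟨((realNext Z w.sim.1 a r).1, w.sim.2), w.func, w.delay, w.served⟩, ⟨r.2.2, none⟩)
      else
        let g := acastForward sender Z i x w.func
        let q := realNext Z w.sim.1 (.activate i g.2) r
        let u := (afterReact Z w i g q.1 q.2.out).serve i
        (u.1, ⟨q.2.advMsg, u.2⟩)

theorem map_bind_pure_eq {α β γ : Type} {p : PMF α} {f : α → β} {h : β → γ} {g : α → γ}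
    (H : ∀ a, h (f a) = g a) : ((p.map f).bind fun b => PMF.pure (h b)) = p.map g := by
  rw [PMF.bind_map]
  exact congrArg p.bind (funext fun a => congrArg PMF.pure (H a))

/-- The simulator adds no randomness to the adversary's, and it presents the event that the
adversary would see in the real world. -/
theorem idealStep_eq {w : IdealWorld (FAcast ℓ sender) (acastSim 𝒵 sender A)}
    (hw : w.sim.2.1 = Z) (a : EnvAction n (List.Vector Bool ℓ)) :
    idealStep (FAcast ℓ sender) (acastSim 𝒵 sender A) Z w a =
      (A.step w.sim.1.adv (advEvent Z a) (w.sim.1.net.map (Packet.view Z))).map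
        (idealNext Z w a) := by
  have hstep (e : SimEvent n (List.Vector Bool ℓ) (List.Vector Bool ℓ))
      (he : (∃ msg, e = .env msg ∧ a = .toAdv msg) ∨
        ∃ i x, e = .corruptInput i x ∧ a = .activate i x) :
      (acastSim 𝒵 sender A).step w.sim e =
        (A.step w.sim.1.adv (advEvent Z a) (w.sim.1.net.map (Packet.view Z))).map fun r =>
          (((realNext Z w.sim.1 a r).1, w.sim.2), [], (realNext Z w.sim.1 a r).2.advMsg) := by
    have : (acastSim 𝒵 sender A).step w.sim e =
        (realStep (AcastProtocol 𝒵 ℓ sender) A w.sim.2.1 w.sim.1 a).bind fun r =>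
          PMF.pure ((r.1, w.sim.2), [], r.2.advMsg) := by
      rcases he with ⟨_, rfl, rfl⟩ | ⟨_, _, rfl, rfl⟩ <;> rfl
    rw [this, hw, realStep_eq]
    exact map_bind_pure_eq fun r => rfl
  rcases a with ⟨i, x⟩ | msg
  · by_cases hi : i ∈ Z
    · simp only [idealStep, if_pos hi]
      rw [hstep _ (.inr ⟨i, x, rfl, rfl⟩)]
      refine map_bind_pure_eq fun r => ?_
      simp only [idealNext, realNext, if_pos hi]
      rfl
    · have hstep' (l : Option (List.Vector Bool ℓ)) :
          (acastSim 𝒵 sender A).step w.sim (.activated i l) =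
          (A.step w.sim.1.adv (advEvent Z (.activate i x)) (w.sim.1.net.map (Packet.view Z))).map
            fun r =>
              let q := realNext Z w.sim.1 (.activate i l) r
              let c := (acastControl n ℓ).react w.sim.2.2 i l q.2.out
              ((q.1, w.sim.2.1, c.1), c.2, q.2.advMsg) := by
        have : (acastSim 𝒵 sender A).step w.sim (.activated i l) =
            (realStep (AcastProtocol 𝒵 ℓ sender) A w.sim.2.1 w.sim.1 (.activate i l)).bind fun r =>
              let c := (acastControl n ℓ).react w.sim.2.2 i l r.2.out
              PMF.pure ((r.1, w.sim.2.1, c.1), c.2, r.2.advMsg) := rfl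
        -- An honest input is hidden from the adversary, so replacing it by the leaked value does
        -- not change the event.
        have he : advEvent Z (.activate i x) = advEvent Z (.activate i l) := by
          simp only [advEvent, if_neg hi]
        rw [this, hw, realStep_eq, he]
        exact map_bind_pure_eq fun r => rfl
      rcases x with _ | x
      all_goals
        simp only [idealStep, if_neg hi]
        rw [hstep']
        refine map_bind_pure_eq fun r => ?_
        simp only [idealNext, if_neg hi]
        rfl
  · simp only [idealStep]
    rw [hstep _ (.inl ⟨msg, rfl, rfl⟩)]
    exact map_bind_pure_eq fun r => rfl

/-- The simulator's message either fixes the still open value of a corrupt sender or is ignored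
because `m` is already recorded. No delay is pending, so the request is answered at once. -/
theorem afterReact_some {w : IdealWorld (FAcast ℓ sender) (acastSim 𝒵 sender A)} {i : Fin n}
    {g : Option (List.Vector Bool ℓ) × Option (List.Vector Bool ℓ)}
    {v : RealWorld (AcastProtocol 𝒵 ℓ sender) A} {m : List.Vector Bool ℓ}
    (hg : g.1 = some m ∨ sender ∈ Z ∧ g.1 = none) (hi : i ∉ w.served) (hd : w.delay i = 0) :
    (afterReact Z w i g v (some m)).serve i =
      (⟨(v, w.sim.2.1, true), some m, w.delay, insert i w.served⟩, some m) := by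
  have h : afterReact Z w i g v (some m) = ⟨(v, w.sim.2.1, true), some m, w.delay, w.served⟩ := by
    obtain ⟨g₁, g₂⟩ := g
    rcases hg with rfl | ⟨hs, rfl⟩
    · simp [afterReact, acastControl, FCmd.apply, FAcast]
    · simp [afterReact, acastControl, FCmd.apply, FAcast, hs]
  rw [h]
  simp [IdealWorld.serve, FAcast, hi, hd]

/-- The delay of 1 is consumed by the very request it suppresses, so an unserved party returns to
delay 0. For a served party it remains, harmlessly, which is why delays are controlled only outside
`served`. -/
theorem afterReact_none {w : IdealWorld (FAcast ℓ sender) (acastSim 𝒵 sender A)} {i : Fin n}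
    {g : Option (List.Vector Bool ℓ) × Option (List.Vector Bool ℓ)}
    {v : RealWorld (AcastProtocol 𝒵 ℓ sender) A}
    (hg : (w.sim.2.2 || g.2.isSome) = g.1.isSome) (hd : i ∉ w.served → w.delay i = 0) :
    ∃ delay : Fin n → ℕ, (∀ j, j ∉ w.served → w.delay j = 0 → delay j = 0) ∧
      (afterReact Z w i g v none).serve i =
        (⟨(v, w.sim.2.1, g.1.isSome), g.1, delay, w.served⟩, none) := by
  obtain ⟨g₁, g₂⟩ := g
  dsimp only at hg
  rcases g₁ with _ | m
  · have h : afterReact Z w i (none, g₂) v none =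
        ⟨(v, w.sim.2.1, false), none, w.delay, w.served⟩ := by
      simp only [afterReact, acastControl]
      rw [hg]
      simp
    refine ⟨w.delay, fun _ _ h => h, ?_⟩
    rw [h]
    simp [IdealWorld.serve, FAcast]
  · have h : afterReact Z w i (some m, g₂) v none =
        ⟨(v, w.sim.2.1, true), some m, Function.update w.delay i (w.delay i + 1), w.served⟩ := by
      simp only [afterReact, acastControl]
      rw [hg]
      simp [FCmd.apply]
    rw [h]
    by_cases hi : i ∈ w.served
    · refine ⟨Function.update w.delay i (w.delay i + 1), fun j hj hj' => ?_, ?_⟩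
      · rw [Function.update_of_ne (by rintro rfl; exact hj hi)]
        exact hj'
      · simp [IdealWorld.serve, FAcast, hi]
    · refine ⟨w.delay, fun j _ h => h, ?_⟩
      simp [IdealWorld.serve, FAcast, hi]

/-- Allows the virtual party to run on the leak instead of the actual input: the protocol ignores
every input but the first one of the sender, and that one is leaked. -/
theorem acastActivation_congr {i : Fin n} {s : AcastState n ℓ} {x y : Option (List.Vector Bool ℓ)}
    (h : (i = sender ∧ s.started = false) → x = y) (recv : List (Fin n × List Bool)) :
    acastActivation 𝒵 sender i s x recv = acastActivation 𝒵 sender i s y recv := by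
  by_cases hs : i = sender ∧ s.started = false
  · rw [h hs]
  · have (y : Option (List.Vector Bool ℓ)) : acastInput sender i ⟨s, [], none⟩ y = ⟨s, [], none⟩ := by
      rcases y with _ | y
      · rfl
      · simp only [acastInput]
        rw [if_neg hs]
    rw [acastActivation, acastActivation, this, this]

/-- Both worlds react in the same way. -/
theorem IdealInv.next {v : RealWorld (AcastProtocol 𝒵 ℓ sender) A}
    {w : IdealWorld (FAcast ℓ sender) (acastSim 𝒵 sender A)} (h : IdealInv Z v w)
    (hQ : Q 3 Finset.univ 𝒵) (hZ : Corruptible 𝒵 Z) (a : EnvAction n (List.Vector Bool ℓ))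
    (r : A.State × List (NetCmd n) × List Bool) :
    (realNext Z v a r).2 = (idealNext Z w a r).2 ∧
      IdealInv Z (realNext Z v a r).1 (idealNext Z w a r).1 := by
  have h₀ := h.commands r
  obtain rfl := h.sim
  rcases a with ⟨i, x⟩ | msg
  swap
  · exact ⟨rfl, h₀⟩
  by_cases hi : i ∈ Z
  · simp only [realNext, idealNext, if_pos hi]
    exact ⟨trivial, h₀⟩
  obtain ⟨⟨⟨adv, party, net₀⟩, Z', b⟩, func, delay, served⟩ := w
  obtain rfl : Z' = Z := h.corrupt
  change Option (List.Vector Bool ℓ) at func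
  change Fin n → AcastState n ℓ at party
  set net := r.2.1.foldl (NetCmd.apply Z') net₀ with hnet
  have hreal : WorldInv 𝒵 sender Z' net party := h₀.real
  have hhonest : sender ∉ Z' → ∀ m, func = some m ↔ Said (traffic net) sender .inp m := h₀.honest
  have hbacked : sender ∈ Z' → ∀ m, func = some m →
      Backed 𝒵 Z' (Said (traffic net)) .ready m := h₀.backed
  have hserved : ∀ i ∉ Z', i ∈ served ↔ (party i).finished = true := h.served
  have hdelay : ∀ i ∉ Z', i ∉ served → delay i = 0 := h.delay
  have hmem : b = func.isSome := h.mem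
  -- For an honest sender, the virtual flag and the functionality agree on whether the first input
  -- has occurred.
  have hstarted (hs : i = sender) : (party i).started = false ↔ func = none := by
    subst hs
    have hflag := (hreal.parties i hi).flag .inp
    rw [← Bool.not_eq_true, show (party i).started = (party i).flag .inp from rfl, hflag]
    simp only [← hhonest hi]
    cases func <;> simp
  set g := acastForward sender Z' i x func with hg
  have hcongr : acastActivation 𝒵 sender i (party i) g.2 (released i net) =
      acastActivation 𝒵 sender i (party i) x (released i net) := by
    refine acastActivation_congr (fun hs => ?_) _
    have hf := (hstarted hs.1).1 hs.2
    subst hf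
    rw [hg, acastForward_of_first hi hs.1]
  generalize hc : acastActivation 𝒵 sender i (party i) x (released i net) = c at hcongr
  have hl := hreal.localInv hZ hi x
  rw [hc] at hl
  have hnew := hreal.activation hZ hi x hc.symm
  have hT : traffic (afterFetch i net ++ outgoing i c.sent) =
      traffic net ++ traffic (outgoing i c.sent) := by
    rw [traffic_append, traffic_afterFetch]
  have hsub (j : Fin n) (t : Kind) (m : List.Vector Bool ℓ) (hm : Said (traffic net) j t m) :
      Said (traffic (afterFetch i net ++ outgoing i c.sent)) j t m := by
    rw [hT]
    exact said_append.2 (.inl hm)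
  -- The functionality records an honest sender's message in the same activation in which the
  -- virtual sender distributes it.
  have hg₁ (hs : sender ∉ Z') (m : List.Vector Bool ℓ) :
      g.1 = some m ↔ Said (traffic (afterFetch i net ++ outgoing i c.sent)) sender .inp m := by
    rw [hT, said_append, ← hhonest hs]
    simp only [Said, mem_traffic_outgoing, ← hc, mem_sent_acastActivation]
    by_cases hf : i = sender ∧ func = none
    · have hst := hstarted hf.1
      obtain ⟨rfl, rfl⟩ := hf
      rw [hg, acastForward_of_first hi rfl]
      have : Nonempty (Fin n) := ⟨i⟩
      simp [hst]
    · rw [hg, acastForward_of_not_first hf]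
      refine (or_iff_left ?_).symm
      rintro ⟨-, -, hs, hst, -⟩
      exact hf ⟨hs, (hstarted hs).1 hst⟩
  have hg₂ (hs : sender ∈ Z') : g.1 = func := by
    rw [hg, acastForward_of_not_first]
    rintro ⟨rfl, -⟩
    exact hi hs
  have hg₃ : (b || g.2.isSome) = g.1.isSome := by
    rw [hmem]
    by_cases hf : i = sender ∧ func = none
    · obtain ⟨rfl, rfl⟩ := hf
      rw [hg, acastForward_of_first hi rfl]
      simp
    · rw [hg, acastForward_of_not_first hf]
      simp
  have hfin (j : Fin n) (hji : j ≠ i) (hj : j ∉ Z') :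
      j ∈ served ↔ (Function.update party i c.st j).finished = true := by
    rw [Function.update_of_ne hji]
    exact hserved j hj
  have hq (y : Option (List.Vector Bool ℓ))
      (hy : acastActivation 𝒵 sender i (party i) y (released i net) = c) :
      realNext Z' (⟨adv, party, net₀⟩ : RealWorld (AcastProtocol 𝒵 ℓ sender) A) (.activate i y) r =
        (⟨r.1, Function.update party i c.st, afterFetch i net ++ outgoing i c.sent⟩,
          ⟨r.2.2, c.out⟩) := by
    subst hy
    simp only [realNext, if_neg hi]
    rfl
  have hideal : idealNext Z' (⟨(⟨adv, party, net₀⟩, Z', b), func, delay, served⟩ :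
      IdealWorld (FAcast ℓ sender) (acastSim 𝒵 sender A)) (.activate i x) r =
      let q := realNext Z' (⟨adv, party, net₀⟩ : RealWorld (AcastProtocol 𝒵 ℓ sender) A)
        (.activate i g.2) r
      let u := (afterReact Z' ⟨(⟨adv, party, net₀⟩, Z', b), func, delay, served⟩ i g q.1
        q.2.out).serve i
      (u.1, ⟨q.2.advMsg, u.2⟩) := by
    simp only [idealNext, if_neg hi]
    rfl
  rw [hq _ hcongr] at hideal
  change (realNext Z' (⟨adv, party, net₀⟩ : RealWorld (AcastProtocol 𝒵 ℓ sender) A)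
      (.activate i x) r).2 = _ ∧ IdealInv Z' (realNext Z' (⟨adv, party, net₀⟩ :
        RealWorld (AcastProtocol 𝒵 ℓ sender) A) (.activate i x) r).1 _
  rw [hideal, hq x hc]
  dsimp only
  rcases ho : c.out with _ | m
  · obtain ⟨delay', hd', he⟩ := afterReact_none (𝒵 := 𝒵) (Z := Z')
      (w := ⟨(⟨adv, party, net₀⟩, Z', b), func, delay, served⟩) (i := i) (g := g)
      (v := ⟨r.1, Function.update party i c.st, afterFetch i net ++ outgoing i c.sent⟩)
      hg₃ (hdelay i hi)
    rw [he]
    refine ⟨rfl, rfl, rfl, rfl, hnew, fun j hj => ?_, fun j hj hjs => hd' j hjs (hdelay j hj hjs),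
      hg₁, fun hs m hm => ?_⟩
    · by_cases hji : j = i
      · subst hji
        have := hl.finished
        rw [ho, Option.isSome_none, Bool.or_false] at this
        change j ∈ served ↔ (Function.update party j c.st j).finished = true
        rw [Function.update_self, this]
        exact hserved j hj
      · exact hfin j hji hj
    · exact (hbacked hs m ((hg₂ hs).symm.trans hm)).mono hsub
  · have hm := (hl.out m ho).mono hsub
    -- A served party has finished in the virtual execution and cannot output again.
    have hni : i ∉ served := fun his => by
      rw [hl.once ((hserved i hi).1 his)] at ho
      cases ho
    -- The virtual output must match the recorded message: by agreement with earlier backing if the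
    -- sender is corrupt, by validity if it is honest. Only a corrupt sender can leave the record
    -- empty here.
    have hgm : g.1 = some m ∨ sender ∈ Z' ∧ g.1 = none := by
      by_cases hs : sender ∈ Z'
      · rw [hg₂ hs]
        rcases hf : func with _ | m'
        · exact .inr ⟨hs, rfl⟩
        · exact .inl (congrArg some
            (hnew.output_unique hQ hZ ((hbacked hs m' hf).mono hsub) hm))
      · exact .inl ((hg₁ hs m).2 (hnew.output_valid hQ hZ hs hm))
    have he := afterReact_some (𝒵 := 𝒵) (Z := Z')
      (w := ⟨(⟨adv, party, net₀⟩, Z', b), func, delay, served⟩) (i := i) (g := g)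
      (v := ⟨r.1, Function.update party i c.st, afterFetch i net ++ outgoing i c.sent⟩)
      hgm hni (hdelay i hi hni)
    rw [he]
    refine ⟨rfl, rfl, rfl, rfl, hnew, fun j hj => ?_, fun j hj hjs => ?_, fun hs m' => ?_,
      fun hs m' hm' => ?_⟩
    · by_cases hji : j = i
      · subst hji
        have := hl.finished
        rw [ho, Option.isSome_some, Bool.or_true] at this
        change j ∈ insert j served ↔ (Function.update party j c.st j).finished = true
        rw [Function.update_self, this]
        simp
      · change j ∈ insert i served ↔ (Function.update party i c.st j).finished = true
        rw [Finset.mem_insert, or_iff_right hji]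
        exact hfin j hji hj
    · exact hdelay j hj fun h => hjs (Finset.mem_insert_of_mem h)
    · rw [← hg₁ hs, hgm.resolve_right fun h => hs h.1]
      rfl
    · obtain rfl : m = m' := Option.some.inj hm'
      exact hm

theorem IdealInv.coupling {v : RealWorld (AcastProtocol 𝒵 ℓ sender) A}
    {w : IdealWorld (FAcast ℓ sender) (acastSim 𝒵 sender A)} (h : IdealInv Z v w)
    (a : EnvAction n (List.Vector Bool ℓ)) :
    ∃ p : PMF (A.State × List (NetCmd n) × List Bool),
      realStep (AcastProtocol 𝒵 ℓ sender) A Z v a = p.map (realNext Z v a) ∧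
      idealStep (FAcast ℓ sender) (acastSim 𝒵 sender A) Z w a = p.map (idealNext Z w a) :=
  ⟨_, realStep_eq v a, by rw [idealStep_eq h.corrupt, h.sim]⟩

theorem acast_real_eq_ideal (hQ : Q 3 Finset.univ 𝒵) (hZ : Corruptible 𝒵 Z) (z : List Bool)
    (E : Environment n (List.Vector Bool ℓ) (List.Vector Bool ℓ)) (k : ℕ) :
    REAL (AcastProtocol 𝒵 ℓ sender) A z Z E k =
      IDEAL (FAcast ℓ sender) (acastSim 𝒵 sender A) z Z E k := by
  refine exec_eq_of_coupling E (IdealInv Z) (fun v w hvw a => ?_) k _ _ (IdealInv.start hQ hZ z)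
  obtain ⟨p, h, h'⟩ := hvw.coupling a
  exact ⟨_, p, _, _, h, h', hvw.next hQ hZ a⟩

theorem acast_eventualDelivery (hQ : Q 3 Finset.univ 𝒵)
    (hdel : A.EventualDelivery 𝒵 (AcastProtocol 𝒵 ℓ sender)) :
    (acastSim 𝒵 sender A).EventualDelivery 𝒵 (FAcast ℓ sender) := by
  intro Z hZ z a w hrun hfair k i hi hout
  -- The virtual party is fed the leak, yet by the coupling the virtual world moves exactly as the
  -- real one would under `a k`. So it is a genuine real run, to which the liveness results apply.
  have hinv (k : ℕ) : IdealInv Z (w k).sim.1 (w k) ∧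
      ∃ o, ((w (k + 1)).sim.1, o) ∈
        (realStep (AcastProtocol 𝒵 ℓ sender) A Z (w k).sim.1 (a k)).support := by
    have hnext (k : ℕ) (h : IdealInv Z (w k).sim.1 (w k)) :
        IdealInv Z (w (k + 1)).sim.1 (w (k + 1)) ∧ ∃ o, ((w (k + 1)).sim.1, o) ∈
          (realStep (AcastProtocol 𝒵 ℓ sender) A Z (w k).sim.1 (a k)).support := by
      obtain ⟨p, hp, hp'⟩ := h.coupling (a k)
      obtain ⟨o, ho⟩ := hrun.2 k
      rw [hp', PMF.mem_support_map_iff] at ho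
      obtain ⟨r, hr, he⟩ := ho
      have h' := (h.next hQ hZ (a k) r).2
      rw [he] at h'
      have hsim := h'.sim
      dsimp only at hsim h'
      rw [← hsim] at h'
      refine ⟨h', (realNext Z (w k).sim.1 (a k) r).2, ?_⟩
      rw [hp, PMF.mem_support_map_iff, hsim]
      exact ⟨r, hr, rfl⟩
    have h₀ (k : ℕ) : IdealInv Z (w k).sim.1 (w k) := by
      induction k with
      | zero =>
        rw [hrun.1]
        exact IdealInv.start hQ hZ z
      | succ k ih => exact (hnext k ih).1
    exact ⟨h₀ k, (hnext k (h₀ k)).2⟩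
  have hreal : IsRun (realStep (AcastProtocol 𝒵 ℓ sender) A Z)
      (RealWorld.start (AcastProtocol 𝒵 ℓ sender) A Z z) a fun k => (w k).sim.1 :=
    ⟨congrArg (fun v => v.sim.1) hrun.1, fun k => (hinv k).2⟩
  obtain ⟨m, hm⟩ := Option.ne_none_iff_exists'.1 hout
  have hready : ∀ j ∉ Z, ∀ᶠ k in Filter.atTop, Said (traffic (w k).sim.1.net) j .ready m := by
    intro j hj
    by_cases hs : sender ∈ Z
    · exact hreal.eventually_ready_of_backed hQ hZ hdel hfair ((hinv k).1.backed hs m hm) hj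
    · exact hreal.eventually_ready_of_input hQ hZ hdel hfair hs (((hinv k).1.honest hs m).1 hm) hj
  obtain ⟨k', hk'⟩ := hreal.finished_of_ready hQ hZ hdel hfair hready hi
  exact ⟨k', ((hinv k').1.served i hi).2 hk'⟩

end Ideal

end AsyncUC

theorem mainTheorem10 :
    ∃ c : ℕ, ∀ (n : ℕ) (𝒵 : Finset (Finset (Fin n))) (ℓ : ℕ) (sender : Fin n),
      AsyncUC.Q 3 Finset.univ 𝒵 →
        AsyncUC.UCSecurelyRealizes 𝒵 (AsyncUC.AcastProtocol 𝒵 ℓ sender) (AsyncUC.FAcast ℓ sender) ∧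
        (1 ≤ ℓ →
          (AsyncUC.AcastProtocol 𝒵 ℓ sender).CommunicationAtMost 𝒵 (c * (n ^ 2 * ℓ))) := by
  refine ⟨9, fun n 𝒵 ℓ sender hQ => ⟨fun A => ?_, fun hℓ A Z hZ z a w hrun k => ?_⟩⟩
  · exact ⟨AsyncUC.acastSim 𝒵 sender A, ⟨AsyncUC.acastControl n ℓ, rfl⟩,
      AsyncUC.acast_eventualDelivery hQ,
      fun Z hZ z E k => AsyncUC.acast_real_eq_ideal hQ hZ z E k⟩
  · rw [AsyncUC.RealWorld.honestBits_eq]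
    exact (hrun.realInv hQ hZ k).bits_le hℓ
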